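/- Let $n,m,l\ge 1$ and $$K=\begin{pmatrix}A&B^T&0\\ B&0&C^T\\ 0&C&D\end{pmatrix},$$ where $A\in\mathbb R^{n\times n}$ is symmetric positive definite (SPD), $B\in\mathbb R^{m\times n}$ has full row rank, $D\in\mathbb R^{l\times l}$ is symmetric positive semidefinite, and $C\in\mathbb R^{l\times m}$ has full row rank whenever $D$ is not SPD. Let $S=BA^{-1}B^T$, and let $M_A\in\mathbb R^{n\times n}$, $\widehat S\in\mathbb R^{m\times m}$, $\widehat M_S\in\mathbb R^{l\times l}$ be SPD. Put $$\Delta=\mathrm{diag}(M_A,-\widehat S,\widehat M_S),\quad L(U,V)=\begin{pmatrix}I&0&0\\ U&I&0\\ 0&V&I\end{pmatrix},\quad R(U,V)=\begin{pmatrix}I&U&0\\ 0&I&V\\ 0&0&I\end{pmatrix},$$ and, with $E=BM_A^{-1}$ and $F=-C\widehat S^{-1}$, define the eight preconditioners $$M_d=\Delta,\quad M_{ut}=\Delta R(E^T,0),\quad M_{lt}=L(E,0)\Delta,\quad M_{f_1}=L(E,0)\Delta R(E^T,0),$$ $$M_{f_2}=L(0,F)\Delta R(0,F^T),\quad M_{f_3}=L(0,F)\Delta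 R(E^T,F^T),\quad M_{f_4}=L(E,F)\Delta R(0,F^T),\quad M_{f_5}=L(E,F)\Delta R(E^T,F^T).$$ Let $\underline\mu,\bar\mu$; $\underline\nu,\bar\nu$; $\underline\omega,\bar\omega$; $\underline\tau,\bar\tau$; $\underline\vartheta,\bar\vartheta$ be the smallest and largest eigenvalues (all eigenvalues being real) of $M_A^{-1}A$; $\widehat S^{-1}S$; $\widehat M_S^{-1}C\widehat S^{-1}C^T$; $\widehat M_S^{-1}D$; $\widehat M_S^{-1}(D+C\widehat S^{-1}C^T)$, respectively. Assume $0<\bar\mu\le2$, $0<\bar\nu\le2$ and $0<\bar\mu\bar\nu<2$. Put $$\underline\delta=\min\{\underline\mu(2-\underline\mu),\bar\mu(2-\bar\mu)\},\qquad \bar\delta=\max\{\underline\mu(2-\underline\mu),\bar\mu(2-\bar\mu),1\},$$ $$\underline h(t)=\begin{cases}\underline\vartheta,&0\le t\le1,\\ \underline\tau+\underline\omega,&1<t\le2,\end{cases}\qquad \bar h(t)=\begin{cases}\bar\vartheta,&0\le t\le1,\\ \bar\tau+\bar\omega,&1<t\le2,\end{cases}$$ $$g_1(s)=1+\tfrac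 s2-\sqrt{\tfrac{s^2}4+s},\quad g_2(s)=1+\tfrac s2+\sqrt{\tfrac{s^2}4+s},\quad \varrho(s,t)=\max\{(s-1)^2,(1-t)^2\},$$ $$\xi_1=\bar\nu-\frac{\bar\nu}{\bar\mu},\quad \xi_2=\frac{\bar\omega\bar\nu}{\underline\mu},\quad \xi_3=(1-\underline\mu)\xi_2,\quad \xi_4=(1-\underline\delta)\xi_2,$$ $$\kappa_1=\lambda_{\max}\bigl(M_A^{-1}A(I-M_A^{-1}A)\bigr),\qquad \kappa_2=\lambda_{\max}\bigl((I-M_A^{-1}A)^2M_A^{-1}A\bigr).$$ Then for each $*\in\{d,ut,lt,f_1,f_2,f_3,f_4,f_5\}$, every (complex) eigenvalue $\lambda_*$ of $M_*^{-1}K$ satisfies $$\underline\eta_*\le \mathrm{Re}(\lambda_*)\le\bar\eta_*,\qquad |\mathrm{Im}(\lambda_*)|\le\rho_*,$$ where $\rho_*=\sqrt{\rho_*^2}$ and $\underline\eta_*,\bar\eta_*,\rho_*^2$ are as follows. 1. $*=d$: $\underline\eta=0$, $\bar\eta=\max\{\bar\mu,\bar\tau\}$, $\rho^2=\bar\omega+\bar\nu\bar\mu$.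 2. $*=ut$ and $*=lt$: - if $\bar\mu\le1$: $\underline\eta=\min\{\underline\mu,\underline\tau,\underline\mu\underline\nu\}$, $\bar\eta=\max\{\bar\mu,\bar\tau,\bar\mu\bar\nu\}$, $\rho^2=\bar\omega+\bar\nu\kappa_1$; - if $\underline\mu\ge1$: $\underline\eta=\min\{\underline\mu g_1(\xi_1),\underline\nu g_1(\xi_1),\underline\tau\}$, $\bar\eta=\max\{\bar\mu g_2(\xi_1),\bar\nu g_2(\xi_1),\bar\tau\}$, $\rho^2=\bar\omega$; - if $\underline\mu<1<\bar\mu$: $\underline\eta=\min\{\underline\mu,\underline\tau,g_1(\xi_1),\underline\mu\underline\nu g_1(\xi_1)\}$, $\bar\eta=\max\{\bar\tau,\bar\mu g_2(\xi_1),\bar\nu g_2(\xi_1)\}$, $\rho^2=\bar\omega+\bar\nu\kappa_1$. 3. $*=f_1$: $\underline\eta=\min\{\underline\mu,\underline\tau,\underline\delta\underline\nu\}$, $\bar\eta=\max\{\bar\mu,\bar\tau,\bar\delta\bar\nu\}$, $\rho^2=\bar\omega+\bar\nu\kappa_2$. 4. $*=f_2$: $\underline\eta=0$, $\bar\eta=\max\{\bar\mu,\bar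 h(\bar\nu)+\bar\omega(1-\underline\nu)\}\,g_2(\xi_2)$, $\rho^2=\bar\omega+\bar\nu\bar\mu$. 5. $*=f_3$ and $*=f_4$: - if $\bar\mu\le1$: $\underline\eta=\min\bigl\{\underline\mu,\ \underline h(\bar\nu)+\underline\omega(1-\bar\nu),\ \tfrac{\underline\mu\underline\nu}{g_1(\xi_3)}\bigr\}g_1(\xi_3)$, $\bar\eta=\max\bigl\{\bar\mu,\ \bar h(\bar\nu)+\bar\omega(1-\underline\nu),\ \tfrac{\bar\mu\bar\nu}{g_2(\xi_3)}\bigr\}g_2(\xi_3)$, $\rho^2=\bar\omega\varrho(\bar\mu\bar\nu,\underline\mu\underline\nu)+\bar\nu\kappa_1$; - if $\underline\mu\ge1$: $\underline\eta=\min\{\underline\mu g_1(\xi_1),\underline\nu g_1(\xi_1),\underline h(\bar\mu\bar\nu)+\underline\omega(1-\bar\mu\bar\nu)\}$, $\bar\eta=\max\{\bar\mu g_2(\xi_1),\bar\nu g_2(\xi_1),\bar h(\bar\mu\bar\nu)+\bar\omega(1-\underline\mu\underline\nu)\}$, $\rho^2=\bar\omega\bigl(\bar\nu\bar\mu(\bar\mu-1)+\varrho(\bar\mu\bar\nu,\underline\mu\underline\nu)\bigr)$;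 - if $\underline\mu<1<\bar\mu$: $\underline\eta=\min\bigl\{\underline\mu,\ \underline h(\bar\mu\bar\nu)+\underline\omega(1-\bar\mu\bar\nu),\ \tfrac{g_1(\xi_1)}{g_1(\xi_3)},\ \tfrac{\underline\mu\underline\nu g_1(\xi_1)}{g_1(\xi_3)}\bigr\}g_1(\xi_3)$, $\bar\eta=\max\bigl\{1,\ \bar h(\bar\mu\bar\nu)+\bar\omega(1-\underline\nu),\ \tfrac{\bar\mu g_2(\xi_1)}{g_2(\xi_3)},\ \tfrac{\bar\nu g_2(\xi_1)}{g_2(\xi_3)}\bigr\}g_2(\xi_3)$, $\rho^2=\bar\omega\bigl(\bar\nu\bar\mu(\bar\mu-1)+\varrho(\bar\mu\bar\nu,\underline\mu\underline\nu)\bigr)+\bar\nu\kappa_1$. 6. $*=f_5$: $\underline\eta=\min\bigl\{\underline\mu,\ \underline h(\bar\nu)+\underline\omega(1-\bar\nu),\ \tfrac{\underline\delta\underline\nu}{g_1(\xi_4)}\bigr\}g_1(\xi_4)$, $\bar\eta=\max\bigl\{\bar\mu,\ \bar h(\bar\nu)+\bar\omega(1-\underline\nu),\ \tfrac{\bar\delta\bar\nu}{g_2(\xi_4)}\bigr\}g_2(\xi_4)$,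 $\rho^2=\bar\omega\varrho(\bar\delta\bar\nu,\underline\delta\underline\nu)+\bar\nu\kappa_2$. (If $\underline\mu=\bar\mu=1$, the first two alternatives in items 2 and 5 give the same values.) -/

import Mathlib

noncomputable section

namespace DoubleSaddle

open Matrix

/-- The smallest real eigenvalue of a real square matrix. It is only used for matrices of positive
order all of whose eigenvalues are real (similar to symmetric matrices), for which the set is
finite and nonempty, so that this is the minimum of all eigenvalues. -/
def lamMin {k : ℕ} (T : Matrix (Fin k) (Fin k) ℝ) : ℝ :=
  sInf {t : ℝ | Module.End.HasEigenvalue (Matrix.toLin' T) t}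

/-- The largest real eigenvalue of a real square matrix; used under the same circumstances. -/
def lamMax {k : ℕ} (T : Matrix (Fin k) (Fin k) ℝ) : ℝ :=
  sSup {t : ℝ | Module.End.HasEigenvalue (Matrix.toLin' T) t}

/-- `g₁ s = 1 + s/2 - √(s²/4 + s)`. -/
def g₁ (s : ℝ) : ℝ := 1 + s / 2 - Real.sqrt (s ^ 2 / 4 + s)

/-- `g₂ s = 1 + s/2 + √(s²/4 + s)`. -/
def g₂ (s : ℝ) : ℝ := 1 + s / 2 + Real.sqrt (s ^ 2 / 4 + s)

/-- `ϱ(s, t) = max {(s - 1)², (1 - t)²}`. -/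
def varrho (s t : ℝ) : ℝ := max ((s - 1) ^ 2) ((1 - t) ^ 2)

/-- A `3 × 3` block matrix, given by its blocks row by row. -/
def block3 {n m l : ℕ}
    (A₁₁ : Matrix (Fin n) (Fin n) ℝ) (A₁₂ : Matrix (Fin n) (Fin m) ℝ)
    (A₁₃ : Matrix (Fin n) (Fin l) ℝ)
    (A₂₁ : Matrix (Fin m) (Fin n) ℝ) (A₂₂ : Matrix (Fin m) (Fin m) ℝ)
    (A₂₃ : Matrix (Fin m) (Fin l) ℝ)
    (A₃₁ : Matrix (Fin l) (Fin n) ℝ) (A₃₂ : Matrix (Fin l) (Fin m) ℝ)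
    (A₃₃ : Matrix (Fin l) (Fin l) ℝ) :
    Matrix (Fin n ⊕ Fin m ⊕ Fin l) (Fin n ⊕ Fin m ⊕ Fin l) ℝ :=
  Matrix.fromBlocks A₁₁ (Matrix.fromCols A₁₂ A₁₃) (Matrix.fromRows A₂₁ A₃₁)
    (Matrix.fromBlocks A₂₂ A₂₃ A₃₂ A₃₃)

/-- The blocks `A, B, C, D` of the coefficient matrix together with the matrices
`M_A`, `Ŝ`, `M̂_S` from which the preconditioners are built (no properties are imposed here). -/
structure BlockData (n m l : ℕ) where
  A : Matrix (Fin n) (Fin n) ℝ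
  B : Matrix (Fin m) (Fin n) ℝ
  C : Matrix (Fin l) (Fin m) ℝ
  D : Matrix (Fin l) (Fin l) ℝ
  MA : Matrix (Fin n) (Fin n) ℝ
  Shat : Matrix (Fin m) (Fin m) ℝ
  MShat : Matrix (Fin l) (Fin l) ℝ

/-- The labels of the eight preconditioners. -/
inductive Precond
  | d | ut | lt | f1 | f2 | f3 | f4 | f5

namespace BlockData

variable {n m l : ℕ} (P : BlockData n m l)

/-- The coefficient matrix `K`. -/
def K : Matrix (Fin n ⊕ Fin m ⊕ Fin l) (Fin n ⊕ Fin m ⊕ Fin l) ℝ :=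
  block3 P.A P.Bᵀ 0
         P.B 0 P.Cᵀ
         0 P.C P.D

/-- The Schur complement `S = B A⁻¹ Bᵀ`. -/
def S : Matrix (Fin m) (Fin m) ℝ := P.B * P.A⁻¹ * P.Bᵀ

/-! ### The eight preconditioners -/

/-- The block diagonal factor `diag(M_A, -Ŝ, M̂_S)`. -/
def diagFactor : Matrix (Fin n ⊕ Fin m ⊕ Fin l) (Fin n ⊕ Fin m ⊕ Fin l) ℝ :=
  block3 P.MA 0 0
         0 (-P.Shat) 0
         0 0 P.MShat

/-- The unit block lower triangular matrix with `(2,1)` block `U` and `(3,2)` block `V`. -/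
def lowerFactor (U : Matrix (Fin m) (Fin n) ℝ) (V : Matrix (Fin l) (Fin m) ℝ) :
    Matrix (Fin n ⊕ Fin m ⊕ Fin l) (Fin n ⊕ Fin m ⊕ Fin l) ℝ :=
  block3 1 0 0
         U 1 0
         0 V 1

/-- The unit block upper triangular matrix with `(1,2)` block `U` and `(2,3)` block `V`. -/
def upperFactor (U : Matrix (Fin n) (Fin m) ℝ) (V : Matrix (Fin m) (Fin l) ℝ) :
    Matrix (Fin n ⊕ Fin m ⊕ Fin l) (Fin n ⊕ Fin m ⊕ Fin l) ℝ :=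
  block3 1 U 0
         0 1 V
         0 0 1

/-- The preconditioners `M_d, M_ut, M_lt, M_f₁, …, M_f₅`. -/
def precond : Precond → Matrix (Fin n ⊕ Fin m ⊕ Fin l) (Fin n ⊕ Fin m ⊕ Fin l) ℝ
  | .d => P.diagFactor
  | .ut => P.diagFactor * upperFactor (P.MA⁻¹ * P.Bᵀ) 0
  | .lt => lowerFactor (P.B * P.MA⁻¹) 0 * P.diagFactor
  | .f1 => lowerFactor (P.B * P.MA⁻¹) 0 * P.diagFactor * upperFactor (P.MA⁻¹ * P.Bᵀ) 0
  | .f2 => lowerFactor 0 (-(P.C * P.Shat⁻¹)) * P.diagFactor *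
      upperFactor 0 (-(P.Shat⁻¹ * P.Cᵀ))
  | .f3 => lowerFactor 0 (-(P.C * P.Shat⁻¹)) * P.diagFactor *
      upperFactor (P.MA⁻¹ * P.Bᵀ) (-(P.Shat⁻¹ * P.Cᵀ))
  | .f4 => lowerFactor (P.B * P.MA⁻¹) (-(P.C * P.Shat⁻¹)) * P.diagFactor *
      upperFactor 0 (-(P.Shat⁻¹ * P.Cᵀ))
  | .f5 => lowerFactor (P.B * P.MA⁻¹) (-(P.C * P.Shat⁻¹)) * P.diagFactor *
      upperFactor (P.MA⁻¹ * P.Bᵀ) (-(P.Shat⁻¹ * P.Cᵀ))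

/-- The set of complex eigenvalues of the preconditioned matrix `M_*⁻¹ K`. -/
def eigenvalues (k : Precond) : Set ℂ :=
  {z : ℂ | Module.End.HasEigenvalue
    (Matrix.toLin' (((P.precond k)⁻¹ * P.K).map Complex.ofReal)) z}

/-! ### The extreme eigenvalues entering the bounds -/

def muMin : ℝ := lamMin (P.MA⁻¹ * P.A)
def muMax : ℝ := lamMax (P.MA⁻¹ * P.A)
def nuMin : ℝ := lamMin (P.Shat⁻¹ * P.S)
def nuMax : ℝ := lamMax (P.Shat⁻¹ * P.S)
def omegaMin : ℝ := lamMin (P.MShat⁻¹ * P.C * P.Shat⁻¹ * P.Cᵀ)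
def omegaMax : ℝ := lamMax (P.MShat⁻¹ * P.C * P.Shat⁻¹ * P.Cᵀ)
def tauMin : ℝ := lamMin (P.MShat⁻¹ * P.D)
def tauMax : ℝ := lamMax (P.MShat⁻¹ * P.D)
def thetaMin : ℝ := lamMin (P.MShat⁻¹ * (P.D + P.C * P.Shat⁻¹ * P.Cᵀ))
def thetaMax : ℝ := lamMax (P.MShat⁻¹ * (P.D + P.C * P.Shat⁻¹ * P.Cᵀ))

def deltaMin : ℝ := min (P.muMin * (2 - P.muMin)) (P.muMax * (2 - P.muMax))

def deltaMax : ℝ := max (max (P.muMin * (2 - P.muMin)) (P.muMax * (2 - P.muMax))) 1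

/-- The lower function `h`; its arguments are in `[0, 2]`. -/
def hMin (t : ℝ) : ℝ := if t ≤ 1 then P.thetaMin else P.tauMin + P.omegaMin

/-- The upper function `h`; its arguments are in `[0, 2]`. -/
def hMax (t : ℝ) : ℝ := if t ≤ 1 then P.thetaMax else P.tauMax + P.omegaMax

def xi₁ : ℝ := P.nuMax - P.nuMax / P.muMax
def xi₂ : ℝ := P.omegaMax * P.nuMax / P.muMin
def xi₃ : ℝ := (1 - P.muMin) * P.xi₂
def xi₄ : ℝ := (1 - P.deltaMin) * P.xi₂

/-- `λ_max(M_A⁻¹ A (I - M_A⁻¹ A))`. -/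
def kappa₁ : ℝ := lamMax (P.MA⁻¹ * P.A * (1 - P.MA⁻¹ * P.A))

/-- `λ_max((I - M_A⁻¹ A)² M_A⁻¹ A)`. -/
def kappa₂ : ℝ := lamMax ((1 - P.MA⁻¹ * P.A) ^ 2 * (P.MA⁻¹ * P.A))

/-! ### The bounds -/

/-- The lower bound for the real parts. -/
def etaMin : Precond → ℝ
  | .d => 0
  | .ut | .lt =>
      if P.muMax ≤ 1 then
        min (min P.muMin P.tauMin) (P.muMin * P.nuMin)
      else if 1 ≤ P.muMin then
        min (min (P.muMin * g₁ P.xi₁) (P.nuMin * g₁ P.xi₁)) P.tauMin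
      else
        min (min (min P.muMin P.tauMin) (g₁ P.xi₁)) (P.muMin * P.nuMin * g₁ P.xi₁)
  | .f1 => min (min P.muMin P.tauMin) (P.deltaMin * P.nuMin)
  | .f2 => 0
  | .f3 | .f4 =>
      if P.muMax ≤ 1 then
        min (min P.muMin (P.hMin P.nuMax + P.omegaMin * (1 - P.nuMax)))
            (P.muMin * P.nuMin / g₁ P.xi₃) * g₁ P.xi₃
      else if 1 ≤ P.muMin then
        min (min (P.muMin * g₁ P.xi₁) (P.nuMin * g₁ P.xi₁))
            (P.hMin (P.muMax * P.nuMax) + P.omegaMin * (1 - P.muMax * P.nuMax))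
      else
        min (min (min P.muMin
              (P.hMin (P.muMax * P.nuMax) + P.omegaMin * (1 - P.muMax * P.nuMax)))
              (g₁ P.xi₁ / g₁ P.xi₃))
            (P.muMin * P.nuMin * g₁ P.xi₁ / g₁ P.xi₃) * g₁ P.xi₃
  | .f5 =>
      min (min P.muMin (P.hMin P.nuMax + P.omegaMin * (1 - P.nuMax)))
          (P.deltaMin * P.nuMin / g₁ P.xi₄) * g₁ P.xi₄

/-- The upper bound for the real parts. -/
def etaMax : Precond → ℝ
  | .d => max P.muMax P.tauMax
  | .ut | .lt =>
      if P.muMax ≤ 1 then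
        max (max P.muMax P.tauMax) (P.muMax * P.nuMax)
      else if 1 ≤ P.muMin then
        max (max (P.muMax * g₂ P.xi₁) (P.nuMax * g₂ P.xi₁)) P.tauMax
      else
        max (max P.tauMax (P.muMax * g₂ P.xi₁)) (P.nuMax * g₂ P.xi₁)
  | .f1 => max (max P.muMax P.tauMax) (P.deltaMax * P.nuMax)
  | .f2 =>
      max P.muMax (P.hMax P.nuMax + P.omegaMax * (1 - P.nuMin)) * g₂ P.xi₂
  | .f3 | .f4 =>
      if P.muMax ≤ 1 then
        max (max P.muMax (P.hMax P.nuMax + P.omegaMax * (1 - P.nuMin)))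
            (P.muMax * P.nuMax / g₂ P.xi₃) * g₂ P.xi₃
      else if 1 ≤ P.muMin then
        max (max (P.muMax * g₂ P.xi₁) (P.nuMax * g₂ P.xi₁))
            (P.hMax (P.muMax * P.nuMax) + P.omegaMax * (1 - P.muMin * P.nuMin))
      else
        max (max (max 1
              (P.hMax (P.muMax * P.nuMax) + P.omegaMax * (1 - P.nuMin)))
              (P.muMax * g₂ P.xi₁ / g₂ P.xi₃))
            (P.nuMax * g₂ P.xi₁ / g₂ P.xi₃) * g₂ P.xi₃
  | .f5 =>
      max (max P.muMax (P.hMax P.nuMax + P.omegaMax * (1 - P.nuMin)))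
          (P.deltaMax * P.nuMax / g₂ P.xi₄) * g₂ P.xi₄

/-- The square of the bound for the imaginary parts. -/
def rhoSq : Precond → ℝ
  | .d => P.omegaMax + P.nuMax * P.muMax
  | .ut | .lt =>
      if P.muMax ≤ 1 then
        P.omegaMax + P.nuMax * P.kappa₁
      else if 1 ≤ P.muMin then
        P.omegaMax
      else
        P.omegaMax + P.nuMax * P.kappa₁
  | .f1 => P.omegaMax + P.nuMax * P.kappa₂
  | .f2 => P.omegaMax + P.nuMax * P.muMax
  | .f3 | .f4 =>
      if P.muMax ≤ 1 then
        P.omegaMax * varrho (P.muMax * P.nuMax) (P.muMin * P.nuMin) + P.nuMax * P.kappa₁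
      else if 1 ≤ P.muMin then
        P.omegaMax * (P.nuMax * P.muMax * (P.muMax - 1) +
          varrho (P.muMax * P.nuMax) (P.muMin * P.nuMin))
      else
        P.omegaMax * (P.nuMax * P.muMax * (P.muMax - 1) +
          varrho (P.muMax * P.nuMax) (P.muMin * P.nuMin)) + P.nuMax * P.kappa₁
  | .f5 =>
      P.omegaMax * varrho (P.deltaMax * P.nuMax) (P.deltaMin * P.nuMin) + P.nuMax * P.kappa₂

/-- The bound for the imaginary parts. -/
def rho (k : Precond) : ℝ := Real.sqrt (P.rhoSq k)

end BlockData

end DoubleSaddle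

end

/-!
A congruence that diagonalizes the pairs `(A, M_A)` and `(D, M̂_S)` and turns `Ŝ` into the identity
reduces everything to `M_A = Ŝ = M̂_S = 1`, `A = diag a`, `D = diag d` (`NormalForm`); the extreme
eigenvalues in the bounds become bounds for `a` and for Hermitian forms (`rayleigh`). All eight
preconditioners are `L(e E, c F) Δ R(f Eᵀ, c Fᵀ)` with switches `e, f, c ∈ {0, 1}`, and
`M⁻¹ K x = z x` is the pencil equation `K x = z M x`. Exchanging `e` and `f` transposes the
pencil, so `ut`, `f₃` have the same eigenvalues as `lt`, `f₄`, and `(e, f)` may be taken in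
`{(0, 0), (1, 1), (1, 0)}`.

After multiplication of the eigenvector by the upper triangular factor, the off-diagonal blocks
between the first two unknowns carry the weight `p = (1 - e A)(1 - f A)`. Splitting
`p = qp² - qm²` and distributing the weights evenly (`exists_reduced_symm`,
`exists_reduced_triangular`) gives a matrix that is symmetric plus skew-symmetric, with first
unknown `X = Xp + Xm`: where `p > 0` the coupling of `X` with `Y` is skew and that with `W` is
symmetric; where `p < 0` it is the other way around. Hence

* the real part of `z` is a convex combination of Rayleigh quotients of two symmetric blocks, one in
  `(Xp, W)`, the other in `(Xm, Y)` (`energy_re`). Each has a block `A` and a Schur complement,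
  `D + C (2 c - c² B A⁻¹ (1 + qm²) Bᵀ) Cᵀ` and `B A⁻¹ (1 - qp²) Bᵀ` respectively, which is compared
  with `S = B A⁻¹ Bᵀ`. The block is `N diag(A, Schur complement) Nᵀ` with `N` unit triangular, and
  `g₁`, `g₂` bound the eigenvalues of `N Nᵀ` (`g₁_mul_le`, `le_g₂_mul`);
* the imaginary part is bounded by the norm of the skew part, whose couplings form the path
  `Xp – Y – W – Xm`; its squared norm is at most the sum of the squared norms of the three blocks
  (`energy_im`, `path_form_le`).

What remains (`bounds_uncoupled`, `bounds_coupled`) is to insert elementary bounds for `qp²` and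
`qm²` as functions of `a` for each preconditioner and each position of the spectrum of `M_A⁻¹ A`
relative to `1`.
-/

noncomputable section

namespace DoubleSaddle

open Matrix

/-! ### Complex vectors and Hermitian forms -/

/-- A real matrix regarded as a complex one. -/
abbrev toC {p q : Type*} (M : Matrix p q ℝ) : Matrix p q ℂ := M.map Complex.ofRealHom

/-- The squared Euclidean norm of a complex vector. -/
def nsq {ι : Type*} [Fintype ι] (v : ι → ℂ) : ℝ := ∑ i, Complex.normSq (v i)

section Basics

variable {ι κ : Type*} [Fintype ι] [Fintype κ]

lemma nsq_nonneg (v : ι → ℂ) : 0 ≤ nsq v :=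
  Finset.sum_nonneg fun _ _ => Complex.normSq_nonneg _

lemma nsq_eq_zero {v : ι → ℂ} (h : nsq v = 0) : v = 0 := by
  funext i
  have := (Finset.sum_eq_zero_iff_of_nonneg fun i _ => Complex.normSq_nonneg (v i)).1 h i
    (Finset.mem_univ i)
  simpa using this

@[simp] lemma nsq_zero : nsq (0 : ι → ℂ) = 0 := by simp [nsq]

lemma star_dotProduct_toC_mulVec (M : Matrix ι κ ℝ) (u : ι → ℂ) (v : κ → ℂ) :
    star u ⬝ᵥ (toC M *ᵥ v) = star (toC Mᵀ *ᵥ u) ⬝ᵥ v := by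
  have h : (toC Mᵀ)ᴴ = toC M := by
    ext i j
    simp [Matrix.conjTranspose_apply]
  rw [star_mulVec, h, dotProduct_mulVec]

lemma star_dotProduct_self (u : ι → ℂ) : star u ⬝ᵥ u = (nsq u : ℂ) := by
  simp [nsq, dotProduct, Complex.normSq_eq_conj_mul_self]

/-- The Cauchy–Schwarz inequality for a diagonally weighted inner product. -/
lemma abs_im_sum_le (f : ι → ℝ) (u v : ι → ℂ) :
    |∑ i, f i * (star (u i) * v i).im| ≤
      √(nsq u) * √(∑ i, f i ^ 2 * Complex.normSq (v i)) := by
  calc |∑ i, f i * (star (u i) * v i).im| ≤ ∑ i, |f i * (star (u i) * v i).im| :=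
        Finset.abs_sum_le_sum_abs _ _
    _ ≤ ∑ i, ‖u i‖ * (|f i| * ‖v i‖) := by
        refine Finset.sum_le_sum fun i _ => ?_
        rw [abs_mul]
        have h := Complex.abs_im_le_norm (star (u i) * v i)
        rw [norm_mul, norm_star] at h
        calc |f i| * |(star (u i) * v i).im| ≤ |f i| * (‖u i‖ * ‖v i‖) := by gcongr
          _ = _ := by ring
    _ ≤ √(∑ i, ‖u i‖ ^ 2) * √(∑ i, (|f i| * ‖v i‖) ^ 2) :=
        Real.sum_mul_le_sqrt_mul_sqrt _ _ _
    _ = _ := by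
        simp only [nsq, mul_pow, sq_abs, Complex.sq_norm]

/-- A Hermitian form `y ↦ ‖y‖² - ∑ τᵢ |(Bᵀ y)ᵢ|²` that is bounded by `k ‖y‖²` on the diagonal is
bounded by `k ‖u‖ ‖v‖` off the diagonal (only the imaginary part is needed). -/
lemma abs_im_form_le (B : Matrix κ ι ℝ) (τ : ι → ℝ) {k : ℝ} (hk : 0 ≤ k)
    (h : ∀ y : κ → ℂ, |nsq y - ∑ i, τ i * Complex.normSq ((toC Bᵀ *ᵥ y) i)| ≤ k * nsq y)
    (u v : κ → ℂ) :
    |(∑ j, (star (u j) * v j).im) -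
        ∑ i, τ i * (star ((toC Bᵀ *ᵥ u) i) * (toC Bᵀ *ᵥ v) i).im| ≤
      k * (√(nsq u) * √(nsq v)) := by
  set N := (∑ j, (star (u j) * v j).im) -
        ∑ i, τ i * (star ((toC Bᵀ *ᵥ u) i) * (toC Bᵀ *ᵥ v) i).im with hN
  -- polarisation with the vectors `s u ± i t v`
  have expand : ∀ (s t : ℝ) (x y : ℂ), Complex.normSq (s * x + (t * Complex.I) * y) =
      s ^ 2 * Complex.normSq x + t ^ 2 * Complex.normSq y - 2 * s * t * (star x * y).im := by
    intro s t x y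
    simp [Complex.normSq_apply]
    ring
  have key : ∀ s t : ℝ,
      nsq (((s : ℂ) • u + ((t : ℂ) * Complex.I) • v)) -
        ∑ i, τ i * Complex.normSq ((toC Bᵀ *ᵥ ((s : ℂ) • u + ((t : ℂ) * Complex.I) • v)) i) =
      s ^ 2 * (nsq u - ∑ i, τ i * Complex.normSq ((toC Bᵀ *ᵥ u) i)) +
      t ^ 2 * (nsq v - ∑ i, τ i * Complex.normSq ((toC Bᵀ *ᵥ v) i)) - 2 * s * t * N := by
    intro s t
    rw [mulVec_add, mulVec_smul, mulVec_smul, hN]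
    simp only [nsq, Pi.add_apply, Pi.smul_apply, smul_eq_mul, expand, mul_sub, mul_add,
      Finset.sum_add_distrib, Finset.sum_sub_distrib, Finset.mul_sum]
    have e1 : ∀ (r : ℝ) (f : ι → ℝ), ∑ i, τ i * (r * f i) = ∑ i, r * (τ i * f i) := by
      intro r f
      exact Finset.sum_congr rfl fun i _ => by ring
    simp only [e1]
    ring
  have nsqkey : ∀ s t : ℝ, nsq (((s : ℂ) • u + ((t : ℂ) * Complex.I) • v)) +
      nsq (((s : ℂ) • u + (((-t : ℝ) : ℂ) * Complex.I) • v)) =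
      2 * (s ^ 2 * nsq u + t ^ 2 * nsq v) := by
    intro s t
    simp only [nsq, Pi.add_apply, Pi.smul_apply, smul_eq_mul, expand,
      Finset.sum_add_distrib, Finset.sum_sub_distrib, ← Finset.mul_sum]
    ring
  have bound : ∀ s t : ℝ, |s * t * N| * 2 ≤ k * (s ^ 2 * nsq u + t ^ 2 * nsq v) := by
    intro s t
    have h1 := abs_le.1 (h ((s : ℂ) • u + ((t : ℂ) * Complex.I) • v))
    have h2 := abs_le.1 (h ((s : ℂ) • u + (((-t : ℝ) : ℂ) * Complex.I) • v))
    have h3 := nsqkey s t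
    rw [key] at h1 h2
    have h4 : k * nsq (((s : ℂ) • u + ((t : ℂ) * Complex.I) • v)) +
      k * nsq (((s : ℂ) • u + (((-t : ℝ) : ℂ) * Complex.I) • v)) =
        2 * (k * (s ^ 2 * nsq u + t ^ 2 * nsq v)) := by rw [← mul_add, h3]; ring
    have : |s * t * N| ≤ k * (s ^ 2 * nsq u + t ^ 2 * nsq v) / 2 := by
      rw [abs_le]
      constructor <;> nlinarith [h1.1, h1.2, h2.1, h2.2]
    linarith
  rcases (nsq_nonneg u).eq_or_lt with hu | hu
  · have : N = 0 := by rw [hN, nsq_eq_zero hu.symm]; simp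
    rw [this, abs_zero]; positivity
  rcases (nsq_nonneg v).eq_or_lt with hv | hv
  · have : N = 0 := by rw [hN, nsq_eq_zero hv.symm]; simp
    rw [this, abs_zero]; positivity
  have hb := bound √(nsq v) √(nsq u)
  have hu' := Real.sqrt_pos.2 hu
  have hv' := Real.sqrt_pos.2 hv
  rw [abs_mul, abs_of_pos (mul_pos hv' hu')] at hb
  have e1 := Real.sq_sqrt hu.le
  have e2 := Real.sq_sqrt hv.le
  have : (√(nsq v) * √(nsq u)) * |N| ≤
      (√(nsq v) * √(nsq u)) * (k * (√(nsq u) * √(nsq v))) := by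
    rw [e1, e2] at hb
    calc _ ≤ k * (nsq v * nsq u) := by linarith
      _ = k * (√(nsq v) ^ 2 * √(nsq u) ^ 2) := by rw [e1, e2]
      _ = _ := by ring
  exact le_of_mul_le_mul_left this (mul_pos hv' hu')

end Basics

/-! ### The functions `g₁` and `g₂` -/

lemma g₁_zero : g₁ 0 = 1 := by simp [g₁]

lemma g₂_zero : g₂ 0 = 1 := by simp [g₂]

lemma g₁_eq {s : ℝ} (hs : 0 ≤ s) : (g₁ s - 1) ^ 2 = s * g₁ s := by
  have := Real.sq_sqrt (show 0 ≤ s ^ 2 / 4 + s by positivity)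
  unfold g₁
  nlinarith

lemma g₂_eq {s : ℝ} (hs : 0 ≤ s) : (g₂ s - 1) ^ 2 = s * g₂ s := by
  have := Real.sq_sqrt (show 0 ≤ s ^ 2 / 4 + s by positivity)
  unfold g₂
  nlinarith

lemma one_le_g₂ {s : ℝ} (hs : 0 ≤ s) : 1 ≤ g₂ s := by
  unfold g₂
  have := Real.sqrt_nonneg (s ^ 2 / 4 + s)
  linarith

lemma g₁_pos {s : ℝ} (hs : 0 ≤ s) : 0 < g₁ s := by
  have : √(s ^ 2 / 4 + s) < 1 + s / 2 := by
    rw [Real.sqrt_lt' (by positivity)]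
    nlinarith
  unfold g₁
  linarith

lemma g₁_le_one {s : ℝ} (hs : 0 ≤ s) : g₁ s ≤ 1 := by
  have : s / 2 ≤ √(s ^ 2 / 4 + s) := Real.le_sqrt_of_sq_le (by nlinarith)
  unfold g₁
  linarith

/-- If `(g - 1)² = ξ g`, the `2 × 2` form `|x + v|² - g |x|² + ((1 - g)/ξ) |v|²` has determinant
zero, so it is `1/(1 - g)` times a square. -/
lemma sheared_form {ξ g : ℝ} (hξ : 0 < ξ) (hg : (g - 1) ^ 2 = ξ * g) (x v : ℂ) :
    (1 - g) * (Complex.normSq (x + v) - g * Complex.normSq x +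
      (1 - g) / ξ * Complex.normSq v) = Complex.normSq ((1 - g : ℝ) * x + v) := by
  have h : (1 - g) * ((1 - g) / ξ) = g := by
    field_simp; linarith
  simp only [Complex.normSq_apply, Complex.add_re, Complex.add_im, Complex.mul_re,
    Complex.mul_im, Complex.ofReal_re, Complex.ofReal_im]
  linear_combination (v.re * v.re + v.im * v.im) * h

variable {ι : Type*} [Fintype ι]

lemma nsq_sheared {ξ g : ℝ} (hξ : 0 < ξ) (hg : (g - 1) ^ 2 = ξ * g) (x v : ι → ℂ) :
    0 ≤ (1 - g) * (nsq (x + v) - g * nsq x + (1 - g) / ξ * nsq v) := by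
  have : (1 - g) * (nsq (x + v) - g * nsq x + (1 - g) / ξ * nsq v) =
      ∑ i, Complex.normSq ((1 - g : ℝ) * x i + v i) := by
    simp only [← sheared_form hξ hg, nsq, Finset.mul_sum, ← Finset.sum_sub_distrib,
      ← Finset.sum_add_distrib, Pi.add_apply]
  rw [this]
  exact Finset.sum_nonneg fun _ _ => Complex.normSq_nonneg _

/-- `g₁ ξ` bounds from below the eigenvalues of `N Nᵀ`, `N` unit triangular with off-diagonal
block of squared norm at most `ξ`. -/
lemma g₁_mul_le {ξ t : ℝ} (hξ : 0 ≤ ξ) {x v : ι → ℂ} (hv : nsq v ≤ ξ * t) :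
    g₁ ξ * (nsq x + t) ≤ nsq (x + v) + t := by
  rcases hξ.eq_or_lt with rfl | hξ'
  · rw [nsq_eq_zero (le_antisymm (by simpa using hv) (nsq_nonneg v)), g₁_zero]
    simp
  have hlt : g₁ ξ < 1 := by
    refine lt_of_le_of_ne (g₁_le_one hξ) fun h => ?_
    have := g₁_eq hξ
    rw [h] at this
    linarith
  have h := nonneg_of_mul_nonneg_right (nsq_sheared hξ' (g₁_eq hξ) x v) (sub_pos.2 hlt)
  have h2 : (1 - g₁ ξ) / ξ * nsq v ≤ (1 - g₁ ξ) * t := by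
    calc (1 - g₁ ξ) / ξ * nsq v ≤ (1 - g₁ ξ) / ξ * (ξ * t) := by
          have := sub_pos.2 hlt
          gcongr
      _ = _ := by field_simp
  linarith

/-- `g₂ ξ` bounds from above the eigenvalues of `N Nᵀ`, `N` unit triangular with off-diagonal
block of squared norm at most `ξ`. -/
lemma le_g₂_mul {ξ t : ℝ} (hξ : 0 ≤ ξ) {x v : ι → ℂ} (hv : nsq v ≤ ξ * t) :
    nsq (x + v) + t ≤ g₂ ξ * (nsq x + t) := by
  rcases hξ.eq_or_lt with rfl | hξ'
  · rw [nsq_eq_zero (le_antisymm (by simpa using hv) (nsq_nonneg v)), g₂_zero]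
    simp
  have hlt : 1 < g₂ ξ := by
    refine lt_of_le_of_ne (one_le_g₂ hξ) fun h => ?_
    have := g₂_eq hξ
    rw [← h] at this
    linarith
  have h := nsq_sheared hξ' (g₂_eq hξ) x v
  have h1 : nsq (x + v) - g₂ ξ * nsq x + (1 - g₂ ξ) / ξ * nsq v ≤ 0 := by
    by_contra hcon
    push Not at hcon
    nlinarith
  have h2 : (g₂ ξ - 1) / ξ * nsq v ≤ (g₂ ξ - 1) * t := by
    calc (g₂ ξ - 1) / ξ * nsq v ≤ (g₂ ξ - 1) / ξ * (ξ * t) := by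
          have := sub_pos.2 hlt
          gcongr
      _ = _ := by field_simp
  have h3 : (1 - g₂ ξ) / ξ = - ((g₂ ξ - 1) / ξ) := by ring
  rw [h3] at h1
  linarith

/-! ### The energy identities -/

/-- The symmetrized eigenvalue equations in normalized coordinates. The first unknown is split into
the part `Xp`, whose coupling with `Y` is skew-symmetric, and `Xm`, whose coupling with `Y` is
symmetric; `qp` and `qm` are the corresponding weights, and `c` switches the coupling through `F` on
or off. The vectors `β = Bᵀ Y`, `G = Cᵀ W`, `γ = Bᵀ G` are abbreviations, and
`R` collects the arguments of `B` in the second equation. The supports of `Xp` and `Xm` need not be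
disjoint for the energy identities. -/
structure ReducedEigen {n m l : ℕ} (a qp qm : Fin n → ℝ) (B : Matrix (Fin m) (Fin n) ℝ)
    (C : Matrix (Fin l) (Fin m) ℝ) (d : Fin l → ℝ) (c : ℝ) (z : ℂ)
    (Xp Xm β γ : Fin n → ℂ) (Y G : Fin m → ℂ) (W : Fin l → ℂ) : Prop where
  hβ : β = toC Bᵀ *ᵥ Y
  hG : G = toC Cᵀ *ᵥ W
  hγ : γ = toC Bᵀ *ᵥ G
  eqp : ∀ i, z * Xp i = a i * Xp i + qp i * (β i + c * γ i)
  eqm : ∀ i, z * Xm i = a i * Xm i + qm i * (β i + c * γ i)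
  eqY : ∃ R : Fin n → ℂ,
    (∀ i, R i = -(qp i * Xp i) + qm i * Xm i +
      ((1 - qp i ^ 2 + qm i ^ 2) / a i : ℝ) * (β i + c * γ i)) ∧
    z • Y = toC B *ᵥ R - G ∧
    ∀ j, z * W j = (toC C *ᵥ (Y + (2 * c : ℂ) • G - (c : ℂ) • (toC B *ᵥ R))) j + d j * W j

variable {n m l : ℕ} {a qp qm : Fin n → ℝ} {B : Matrix (Fin m) (Fin n) ℝ}
  {C : Matrix (Fin l) (Fin m) ℝ} {d : Fin l → ℝ} {c : ℝ} {z : ℂ}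
  {Xp Xm β γ : Fin n → ℂ} {Y G : Fin m → ℂ} {W : Fin l → ℂ}

/-- The inner product of the equations with the vector of unknowns. -/
lemma energy_complex (h : ReducedEigen a qp qm B C d c z Xp Xm β γ Y G W) :
    ∃ R : Fin n → ℂ,
    (∀ i, R i = -(qp i * Xp i) + qm i * Xm i +
      ((1 - qp i ^ 2 + qm i ^ 2) / a i : ℝ) * (β i + c * γ i)) ∧
    z * ((nsq Xp + nsq Xm + nsq Y + nsq W : ℝ) : ℂ) =
      (∑ i, (star (Xp i) * (a i * Xp i + qp i * (β i + c * γ i)) +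
        star (Xm i) * (a i * Xm i + qm i * (β i + c * γ i)) +
        star (β i) * R i - c * (star (γ i) * R i))) +
      (∑ k, (star (G k) * Y k - star (Y k) * G k + 2 * c * (star (G k) * G k))) +
      ∑ j, d j * (star (W j) * W j) := by
  obtain ⟨R, hR, hY, hW⟩ := h.eqY
  refine ⟨R, hR, ?_⟩
  have e1 : z * (nsq Y : ℂ) = star β ⬝ᵥ R - star Y ⬝ᵥ G := by
    rw [← star_dotProduct_self, ← smul_eq_mul, ← dotProduct_smul, hY, dotProduct_sub,
      star_dotProduct_toC_mulVec, ← h.hβ]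
  have hW' : z • W = (toC C *ᵥ (Y + (2 * c : ℂ) • G - (c : ℂ) • (toC B *ᵥ R))) +
      fun j => (d j : ℂ) * W j := funext fun j => by simpa using hW j
  have e2 : z * (nsq W : ℂ) = star G ⬝ᵥ Y + 2 * c * (star G ⬝ᵥ G) - c * (star γ ⬝ᵥ R) +
      star W ⬝ᵥ (fun j => (d j : ℂ) * W j) := by
    rw [← star_dotProduct_self, ← smul_eq_mul, ← dotProduct_smul, hW', dotProduct_add,
      star_dotProduct_toC_mulVec, ← h.hG, dotProduct_sub, dotProduct_add, dotProduct_smul,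
      dotProduct_smul, star_dotProduct_toC_mulVec, ← h.hγ]
    simp
  have e3 : z * (nsq Xp : ℂ) = ∑ i, star (Xp i) * (a i * Xp i + qp i * (β i + c * γ i)) := by
    rw [← star_dotProduct_self, dotProduct, Finset.mul_sum]
    refine Finset.sum_congr rfl fun i _ => ?_
    rw [← h.eqp, Pi.star_apply]; ring
  have e4 : z * (nsq Xm : ℂ) = ∑ i, star (Xm i) * (a i * Xm i + qm i * (β i + c * γ i)) := by
    rw [← star_dotProduct_self, dotProduct, Finset.mul_sum]
    refine Finset.sum_congr rfl fun i _ => ?_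
    rw [← h.eqm, Pi.star_apply]; ring
  push_cast
  rw [mul_add, mul_add, mul_add, e1, e2, e3, e4]
  simp only [dotProduct, Pi.star_apply, Finset.sum_add_distrib, Finset.sum_sub_distrib,
    Finset.mul_sum]
  have e5 : ∀ j, star (W j) * ((d j : ℂ) * W j) = d j * (star (W j) * W j) := fun j => by ring
  simp only [e5]
  ring

/-- The real part of the energy, as a sum of two sheared block forms: one couples `Xp` with `W`,
the other `Xm` with `Y`. -/
lemma energy_re (ha : ∀ i, 0 < a i) (h : ReducedEigen a qp qm B C d c z Xp Xm β γ Y G W) :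
    z.re * (nsq Xp + nsq Xm + nsq Y + nsq W) =
      (∑ i, a i * Complex.normSq (Xp i + (c * qp i / a i : ℝ) * γ i)) +
      ((∑ j, d j * Complex.normSq (W j)) + 2 * c * nsq G -
        c ^ 2 * ∑ i, (1 + qm i ^ 2) / a i * Complex.normSq (γ i)) +
      ((∑ i, a i * Complex.normSq (Xm i + (qm i / a i : ℝ) * β i)) +
        ∑ i, (1 - qp i ^ 2) / a i * Complex.normSq (β i)) := by
  obtain ⟨R, hR, hz⟩ := energy_complex h
  have hz' := congrArg Complex.re hz
  rw [Complex.re_mul_ofReal] at hz'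
  rw [hz']
  have per : ∀ i, (star (Xp i) * (a i * Xp i + qp i * (β i + c * γ i)) +
        star (Xm i) * (a i * Xm i + qm i * (β i + c * γ i)) +
        star (β i) * R i - c * (star (γ i) * R i)).re =
      a i * Complex.normSq (Xp i + (c * qp i / a i : ℝ) * γ i) -
      c ^ 2 * ((1 + qm i ^ 2) / a i * Complex.normSq (γ i)) +
      a i * Complex.normSq (Xm i + (qm i / a i : ℝ) * β i) +
      (1 - qp i ^ 2) / a i * Complex.normSq (β i) := by
    intro i
    have hai := (ha i).ne'
    rw [hR]
    simp only [Complex.normSq_apply, Complex.add_re, Complex.add_im, Complex.mul_re,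
      Complex.mul_im, Complex.ofReal_re, Complex.ofReal_im, Complex.sub_re,
      Complex.neg_re, Complex.neg_im, Complex.star_def, Complex.conj_re, Complex.conj_im]
    field_simp
    ring
  have perG : ∀ k, (star (G k) * Y k - star (Y k) * G k + 2 * c * (star (G k) * G k)).re =
      2 * c * Complex.normSq (G k) := by
    intro k
    simp [Complex.normSq_apply]
    ring
  have perW : ∀ j, ((d j : ℂ) * (star (W j) * W j)).re = d j * Complex.normSq (W j) := by
    intro j
    simp [Complex.normSq_apply]
  rw [Complex.add_re, Complex.add_re, Complex.re_sum, Complex.re_sum, Complex.re_sum]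
  simp only [per, perG, perW, nsq, Finset.sum_add_distrib, Finset.sum_sub_distrib, Finset.mul_sum]
  ring

/-- The imaginary part of the energy. -/
lemma energy_im (h : ReducedEigen a qp qm B C d c z Xp Xm β γ Y G W) :
    z.im * (nsq Xp + nsq Xm + nsq Y + nsq W) =
      2 * ((∑ i, qp i * (star (Xp i) * β i).im) + (∑ i, c * qm i * (star (Xm i) * γ i).im) +
      ((∑ k, (star (G k) * Y k).im) -
        c * ∑ i, (1 - qp i ^ 2 + qm i ^ 2) / a i * (star (γ i) * β i).im)) := by
  obtain ⟨R, hR, hz⟩ := energy_complex h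
  have hz' := congrArg Complex.im hz
  rw [Complex.im_mul_ofReal] at hz'
  rw [hz']
  have per : ∀ i, (star (Xp i) * (a i * Xp i + qp i * (β i + c * γ i)) +
        star (Xm i) * (a i * Xm i + qm i * (β i + c * γ i)) +
        star (β i) * R i - c * (star (γ i) * R i)).im =
      2 * (qp i * (star (Xp i) * β i).im) + 2 * (c * qm i * (star (Xm i) * γ i).im) -
      2 * (c * ((1 - qp i ^ 2 + qm i ^ 2) / a i * (star (γ i) * β i).im)) := by
    intro i
    rw [hR]
    simp only [Complex.add_re, Complex.add_im, Complex.mul_re,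
      Complex.mul_im, Complex.ofReal_re, Complex.ofReal_im, Complex.sub_im,
      Complex.neg_re, Complex.neg_im, Complex.star_def, Complex.conj_re, Complex.conj_im]
    ring
  have perG : ∀ k, (star (G k) * Y k - star (Y k) * G k + 2 * c * (star (G k) * G k)).im =
      2 * (star (G k) * Y k).im := by
    intro k
    simp
    ring
  have perW : ∀ j, ((d j : ℂ) * (star (W j) * W j)).im = 0 := by
    intro j
    simp
    ring_nf
    simp
  rw [Complex.add_im, Complex.add_im, Complex.im_sum, Complex.im_sum, Complex.im_sum]
  simp only [per, perG, perW, Finset.sum_add_distrib, Finset.sum_sub_distrib, ← Finset.mul_sum,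
    Finset.sum_const_zero]
  ring

/-- The norm of the bipartite skew part with edges `x – y` (weight `P`), `y – w` (weight `Q`) and
`w – v` (weight `R`) is at most `√(P² + Q² + R²)`. -/
lemma path_form_le {P Q R x y w v : ℝ} :
    2 * (P * (x * y) + R * (v * w) + Q * (w * y)) ≤
      √(P ^ 2 + Q ^ 2 + R ^ 2) * (x ^ 2 + v ^ 2 + y ^ 2 + w ^ 2) := by
  set r := √(P ^ 2 + Q ^ 2 + R ^ 2) with hr
  have hr0 : 0 ≤ r := Real.sqrt_nonneg _
  have hr2 : r ^ 2 = P ^ 2 + Q ^ 2 + R ^ 2 := Real.sq_sqrt (by positivity)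
  have h1 : ((P * x + Q * w) * y + (R * w) * v) ^ 2 ≤
      ((P * x + Q * w) ^ 2 + (R * w) ^ 2) * (y ^ 2 + v ^ 2) := by
    nlinarith [sq_nonneg ((P * x + Q * w) * v - (R * w) * y)]
  have h2 : (P * x + Q * w) ^ 2 + (R * w) ^ 2 ≤ r ^ 2 * (x ^ 2 + w ^ 2) := by
    rw [hr2]
    nlinarith [sq_nonneg (P * w - Q * x), sq_nonneg (R * x)]
  have h3 : ((P * x + Q * w) * y + (R * w) * v) ^ 2 ≤
      (r * ((x ^ 2 + w ^ 2 + (y ^ 2 + v ^ 2)) / 2)) ^ 2 := by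
    calc _ ≤ r ^ 2 * (x ^ 2 + w ^ 2) * (y ^ 2 + v ^ 2) := h1.trans (by gcongr)
      _ ≤ _ := by
        have : (x ^ 2 + w ^ 2) * (y ^ 2 + v ^ 2) ≤
          ((x ^ 2 + w ^ 2 + (y ^ 2 + v ^ 2)) / 2) ^ 2 := by
          nlinarith [sq_nonneg ((x ^ 2 + w ^ 2) - (y ^ 2 + v ^ 2))]
        rw [mul_pow, mul_assoc]
        gcongr
  have h4 := abs_le_of_sq_le_sq h3 (by positivity)
  have h5 := (abs_le.1 h4).2
  linarith

/-- Lower bound for a sheared block form. -/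
lemma block_lower {x v : Fin n → ℂ} {t s lo lw ξ η : ℝ} (hξ : 0 ≤ ξ) (ht : 0 ≤ t)
    (hlo : ∀ i, lo ≤ a i ∨ x i = 0 ∧ v i = 0) (hlo0 : 0 ≤ lo) (hlw0 : 0 ≤ lw)
    (hs : lw * t ≤ s) (hv : nsq v ≤ ξ * t) (h1 : η ≤ lo * g₁ ξ) (h2 : η ≤ lw * g₁ ξ) :
    η * (nsq x + t) ≤ (∑ i, a i * Complex.normSq (x i + v i)) + s := by
  have hg := g₁_mul_le (x := x) hξ hv
  have hmin : 0 ≤ min lo lw := le_min hlo0 hlw0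
  have hη : η ≤ min lo lw * g₁ ξ := by
    rw [min_mul_of_nonneg _ _ (g₁_pos hξ).le]
    exact le_min h1 h2
  have hsum : min lo lw * nsq (x + v) ≤ ∑ i, a i * Complex.normSq (x i + v i) := by
    rw [nsq, Finset.mul_sum]
    refine Finset.sum_le_sum fun i _ => ?_
    rcases hlo i with hi | ⟨hx, hv⟩
    · exact mul_le_mul_of_nonneg_right ((min_le_left _ _).trans hi) (Complex.normSq_nonneg _)
    · simp [hx, hv]
  have hx := nsq_nonneg x
  calc η * (nsq x + t) ≤ min lo lw * g₁ ξ * (nsq x + t) := by gcongr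
    _ = min lo lw * (g₁ ξ * (nsq x + t)) := by ring
    _ ≤ min lo lw * (nsq (x + v) + t) := by gcongr
    _ = min lo lw * nsq (x + v) + min lo lw * t := by ring
    _ ≤ _ := by
      have : min lo lw * t ≤ lw * t := by gcongr; exact min_le_right _ _
      linarith

/-- Upper bound for a sheared block form. -/
lemma block_upper {x v : Fin n → ℂ} {t s up uw ξ η : ℝ} (hξ : 0 ≤ ξ) (ht : 0 ≤ t)
    (hup : ∀ i, a i ≤ up ∨ x i = 0 ∧ v i = 0) (hup0 : 0 ≤ up)
    (hs : s ≤ uw * t) (hv : nsq v ≤ ξ * t) (h1 : up * g₂ ξ ≤ η) (h2 : uw * g₂ ξ ≤ η) :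
    (∑ i, a i * Complex.normSq (x i + v i)) + s ≤ η * (nsq x + t) := by
  have hg := le_g₂_mul (x := x) hξ hv
  have hg0 : 0 ≤ g₂ ξ := zero_le_one.trans (one_le_g₂ hξ)
  have hmax : 0 ≤ max up uw := hup0.trans (le_max_left _ _)
  have hη : max up uw * g₂ ξ ≤ η := by
    rw [max_mul_of_nonneg _ _ hg0]
    exact max_le h1 h2
  have hsum : ∑ i, a i * Complex.normSq (x i + v i) ≤ max up uw * nsq (x + v) := by
    rw [nsq, Finset.mul_sum]
    refine Finset.sum_le_sum fun i _ => ?_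
    rcases hup i with hi | ⟨hx, hv⟩
    · exact mul_le_mul_of_nonneg_right (hi.trans (le_max_left _ _)) (Complex.normSq_nonneg _)
    · simp [hx, hv]
  have hx := nsq_nonneg x
  have h3 : uw * t ≤ max up uw * t := by gcongr; exact le_max_right _ _
  calc _ ≤ max up uw * nsq (x + v) + max up uw * t := by linarith
    _ = max up uw * (nsq (x + v) + t) := by ring
    _ ≤ max up uw * (g₂ ξ * (nsq x + t)) := by gcongr
    _ = max up uw * g₂ ξ * (nsq x + t) := by ring
    _ ≤ _ := by gcongr

lemma nsq_real_smul (f : Fin n → ℝ) (v : Fin n → ℂ) :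
    nsq (fun i => (f i : ℂ) * v i) = ∑ i, f i ^ 2 * Complex.normSq (v i) := by
  simp [nsq, Complex.normSq_mul, Complex.normSq_ofReal, sq]

/-- Bounds for the real part of an eigenvalue from bounds for the blocks. -/
theorem re_bounds (ha : ∀ i, 0 < a i) (h : ReducedEigen a qp qm B C d c z Xp Xm β γ Y G W)
    (hne : 0 < nsq Xp + nsq Xm + nsq Y + nsq W)
    {lop upp lom upm lw uw ly uy ξp ξm ηl ηu : ℝ}
    (hξp0 : 0 ≤ ξp) (hξm0 : 0 ≤ ξm)
    (hp : ∀ i, (lop ≤ a i ∧ a i ≤ upp) ∨ (Xp i = 0 ∧ qp i = 0))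
    (hm : ∀ i, (lom ≤ a i ∧ a i ≤ upm) ∨ (Xm i = 0 ∧ qm i = 0))
    (hlop : 0 ≤ lop) (hlom : 0 ≤ lom) (hupp : 0 ≤ upp) (hupm : 0 ≤ upm)
    (hlw : 0 ≤ lw) (hly : 0 ≤ ly)
    (hW : lw * nsq W ≤ (∑ j, d j * Complex.normSq (W j)) + 2 * c * nsq G -
        c ^ 2 * ∑ i, (1 + qm i ^ 2) / a i * Complex.normSq (γ i) ∧
      (∑ j, d j * Complex.normSq (W j)) + 2 * c * nsq G -
        c ^ 2 * ∑ i, (1 + qm i ^ 2) / a i * Complex.normSq (γ i) ≤ uw * nsq W)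
    (hY : ly * nsq Y ≤ ∑ i, (1 - qp i ^ 2) / a i * Complex.normSq (β i) ∧
      ∑ i, (1 - qp i ^ 2) / a i * Complex.normSq (β i) ≤ uy * nsq Y)
    (hξp : ∑ i, (c * qp i / a i) ^ 2 * Complex.normSq (γ i) ≤ ξp * nsq W)
    (hξm : ∑ i, (qm i / a i) ^ 2 * Complex.normSq (β i) ≤ ξm * nsq Y)
    (hl1 : ηl ≤ lop * g₁ ξp) (hl2 : ηl ≤ lw * g₁ ξp)
    (hl3 : ηl ≤ lom * g₁ ξm) (hl4 : ηl ≤ ly * g₁ ξm)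
    (hu1 : upp * g₂ ξp ≤ ηu) (hu2 : uw * g₂ ξp ≤ ηu)
    (hu3 : upm * g₂ ξm ≤ ηu) (hu4 : uy * g₂ ξm ≤ ηu) :
    ηl ≤ z.re ∧ z.re ≤ ηu := by
  have E := energy_re ha h
  rw [← nsq_real_smul] at hξp hξm
  have p0 : ∀ i, (Xp i = 0 ∧ qp i = 0) →
      (Xp i = 0 ∧ ((c * qp i / a i : ℝ) : ℂ) * γ i = 0) := by
    rintro i ⟨h1, h2⟩
    simp [h1, h2]
  have m0 : ∀ i, (Xm i = 0 ∧ qm i = 0) →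
      (Xm i = 0 ∧ ((qm i / a i : ℝ) : ℂ) * β i = 0) := by
    rintro i ⟨h1, h2⟩
    simp [h1, h2]
  have l1 := block_lower (a := a) (x := Xp) (v := fun i => ((c * qp i / a i : ℝ) : ℂ) * γ i) hξp0
    (nsq_nonneg W) (fun i => (hp i).imp And.left (p0 i)) hlop hlw hW.1 hξp hl1 hl2
  have l2 := block_lower (a := a) (x := Xm) (v := fun i => ((qm i / a i : ℝ) : ℂ) * β i) hξm0
    (nsq_nonneg Y) (fun i => (hm i).imp And.left (m0 i)) hlom hly hY.1 hξm hl3 hl4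
  have u1 := block_upper (a := a) (x := Xp) (v := fun i => ((c * qp i / a i : ℝ) : ℂ) * γ i) hξp0
    (nsq_nonneg W) (fun i => (hp i).imp And.right (p0 i)) hupp hW.2 hξp hu1 hu2
  have u2 := block_upper (a := a) (x := Xm) (v := fun i => ((qm i / a i : ℝ) : ℂ) * β i) hξm0
    (nsq_nonneg Y) (fun i => (hm i).imp And.right (m0 i)) hupm hY.2 hξm hu3 hu4
  rw [← add_assoc] at E
  constructor
  · refine le_of_mul_le_mul_right ?_ hne
    rw [E]
    linarith
  · refine le_of_mul_le_mul_right ?_ hne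
    rw [E]
    linarith

/-- Bounds for the imaginary part of an eigenvalue from bounds for the coupling blocks. -/
theorem im_bound (h : ReducedEigen a qp qm B C d c z Xp Xm β γ Y G W)
    (hne : 0 < nsq Xp + nsq Xm + nsq Y + nsq W) {p q r ρ : ℝ}
    (hp0 : 0 ≤ p) (hq0 : 0 ≤ q) (hr0 : 0 ≤ r)
    (hp : ∑ i, qp i ^ 2 * Complex.normSq (β i) ≤ p * nsq Y)
    (hr : ∑ i, (c * qm i) ^ 2 * Complex.normSq (γ i) ≤ r * nsq W)
    (hq : |(∑ k, (star (G k) * Y k).im) -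
        c * ∑ i, (1 - qp i ^ 2 + qm i ^ 2) / a i * (star (γ i) * β i).im| ≤
      √q * (√(nsq W) * √(nsq Y)))
    (hρ : p + q + r ≤ ρ) : |z.im| ≤ √ρ := by
  have E := energy_im h
  have b1 : |∑ i, qp i * (star (Xp i) * β i).im| ≤ √p * (√(nsq Xp) * √(nsq Y)) := by
    refine (abs_im_sum_le qp Xp β).trans ?_
    calc _ ≤ √(nsq Xp) * √(p * nsq Y) := by gcongr
      _ = _ := by rw [Real.sqrt_mul hp0]; ring
  have b2 : |∑ i, c * qm i * (star (Xm i) * γ i).im| ≤ √r * (√(nsq Xm) * √(nsq W)) := by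
    refine (abs_im_sum_le (fun i => c * qm i) Xm γ).trans ?_
    calc _ ≤ √(nsq Xm) * √(r * nsq W) := by gcongr
      _ = _ := by rw [Real.sqrt_mul hr0]; ring
  have pf := path_form_le (P := √p) (Q := √q) (R := √r) (x := √(nsq Xp)) (y := √(nsq Y))
    (w := √(nsq W)) (v := √(nsq Xm))
  simp only [Real.sq_sqrt hp0, Real.sq_sqrt hq0, Real.sq_sqrt hr0,
    Real.sq_sqrt (nsq_nonneg _)] at pf
  refine le_trans ?_ (Real.sqrt_le_sqrt hρ)
  refine le_of_mul_le_mul_right ?_ hne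
  refine le_trans ?_ pf
  have habs : |z.im| * (nsq Xp + nsq Xm + nsq Y + nsq W) =
      |z.im * (nsq Xp + nsq Xm + nsq Y + nsq W)| := by rw [abs_mul, abs_of_pos hne]
  rw [habs, E, abs_mul, abs_two]
  refine mul_le_mul_of_nonneg_left ?_ zero_le_two
  refine (abs_add_le _ _).trans (add_le_add ((abs_add_le _ _).trans (add_le_add b1 b2)) hq)

/-! ### Simultaneous diagonalization and extreme eigenvalues -/

lemma exists_orthogonal_diagonalization {k : ℕ} {H : Matrix (Fin k) (Fin k) ℝ}
    (hH : H.IsHermitian) :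
    ∃ (U : Matrix (Fin k) (Fin k) ℝ) (h : Fin k → ℝ), Uᵀ * U = 1 ∧ Uᵀ * H * U = diagonal h := by
  have hs : ∀ U : Matrix (Fin k) (Fin k) ℝ, star U = Uᵀ := fun U => by
    rw [star_eq_conjTranspose, conjTranspose_eq_transpose_of_trivial]
  refine ⟨hH.eigenvectorUnitary, hH.eigenvalues, ?_, ?_⟩
  · rw [← hs]
    exact Unitary.coe_star_mul_self _
  · have := hH.conjStarAlgAut_star_eigenvectorUnitary
    rw [Unitary.conjStarAlgAut_star_apply, hs] at this
    simpa [Function.comp_def] using this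

/-- A positive definite matrix is congruent to the identity. -/
lemma exists_congruent_one {k : ℕ} {M : Matrix (Fin k) (Fin k) ℝ} (hM : M.PosDef) :
    ∃ X : Matrix (Fin k) (Fin k) ℝ, Xᵀ * M * X = 1 := by
  obtain ⟨U, h, hU, hd⟩ := exists_orthogonal_diagonalization hM.1
  have hpos : ∀ i, 0 < h i := by
    intro i
    have hUu : IsUnit U := IsUnit.of_mul_eq_one_right _ hU
    have h1 : (Uᵀ * M * U).PosDef := by
      have := hM.conjTranspose_mul_mul_same (B := U) (mulVec_injective_iff_isUnit.2 hUu)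
      rwa [conjTranspose_eq_transpose_of_trivial] at this
    rw [hd] at h1
    simpa using h1.diag_pos (i := i)
  refine ⟨U * diagonal (fun i => (√(h i))⁻¹), ?_⟩
  rw [transpose_mul, diagonal_transpose]
  have : diagonal (fun i => (√(h i))⁻¹) * Uᵀ * M * (U * diagonal (fun i => (√(h i))⁻¹)) =
      diagonal (fun i => (√(h i))⁻¹) * (Uᵀ * M * U) * diagonal (fun i => (√(h i))⁻¹) := by
    simp only [Matrix.mul_assoc]
  rw [this, hd, diagonal_mul_diagonal, diagonal_mul_diagonal, ← diagonal_one]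
  congr 1
  funext i
  have := Real.sq_sqrt (hpos i).le
  have h2 := (Real.sqrt_pos.2 (hpos i)).ne'
  field_simp
  exact this.symm

lemma exists_simultaneous_diagonalization {k : ℕ} {M H : Matrix (Fin k) (Fin k) ℝ}
    (hM : M.PosDef) (hH : H.IsHermitian) :
    ∃ (X : Matrix (Fin k) (Fin k) ℝ) (h : Fin k → ℝ),
      Xᵀ * M * X = 1 ∧ Xᵀ * H * X = diagonal h := by
  obtain ⟨X, hX⟩ := exists_congruent_one hM
  have hH' : (Xᵀ * H * X).IsHermitian := by
    have := isHermitian_conjTranspose_mul_mul X hH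
    rwa [conjTranspose_eq_transpose_of_trivial] at this
  obtain ⟨U, h, hU, hd⟩ := exists_orthogonal_diagonalization hH'
  refine ⟨X * U, h, ?_, ?_⟩
  · calc (X * U)ᵀ * M * (X * U) = Uᵀ * (Xᵀ * M * X) * U := by
          rw [transpose_mul]; simp only [Matrix.mul_assoc]
      _ = 1 := by rw [hX, Matrix.mul_one, hU]
  · rw [← hd, transpose_mul]; simp only [Matrix.mul_assoc]

/-- If `Xᵀ M X = 1`, then `M⁻¹ = X Xᵀ`. -/
lemma inv_of_congruent_one {k : ℕ} {M X : Matrix (Fin k) (Fin k) ℝ} (hX : Xᵀ * M * X = 1) :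
    M⁻¹ = X * Xᵀ := by
  refine inv_eq_left_inv ?_
  rw [Matrix.mul_assoc]
  exact mul_eq_one_comm.1 hX

lemma isUnit_of_congruent_one {k : ℕ} {M X : Matrix (Fin k) (Fin k) ℝ} (hX : Xᵀ * M * X = 1) :
    IsUnit X := IsUnit.of_mul_eq_one_right _ hX

lemma hasEigenvalue_toLin'_iff {ι R : Type*} [Fintype ι] [DecidableEq ι] [CommRing R]
    {N : Matrix ι ι R} {t : R} :
    Module.End.HasEigenvalue (Matrix.toLin' N) t ↔ ∃ v, v ≠ 0 ∧ N *ᵥ v = t • v := by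
  constructor
  · intro h
    obtain ⟨v, hv⟩ := h.exists_hasEigenvector
    exact ⟨v, hv.2, by simpa using hv.apply_eq_smul⟩
  · rintro ⟨v, hv, h⟩
    exact Module.End.hasEigenvalue_of_hasEigenvector
      (Module.End.hasEigenvector_iff.2 ⟨Module.End.mem_eigenspace_iff.2 (by simpa using h), hv⟩)

section Extreme

variable {k : ℕ} {N X : Matrix (Fin k) (Fin k) ℝ} {f : Fin k → ℝ}

lemma eigenvalues_eq_range (hX : IsUnit X) (h : N * X = X * diagonal f) :
    {t : ℝ | Module.End.HasEigenvalue (Matrix.toLin' N) t} = Set.range f := by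
  have hinj := mulVec_injective_iff_isUnit.2 hX
  ext t
  rw [Set.mem_ofPred_eq, hasEigenvalue_toLin'_iff, Set.mem_range]
  constructor
  · rintro ⟨v, hv, hN⟩
    obtain ⟨u, rfl⟩ := (mulVec_surjective_iff_isUnit.2 hX) v
    rw [mulVec_mulVec, h, ← mulVec_mulVec, ← mulVec_smul] at hN
    have h1 := hinj hN
    have hu : u ≠ 0 := by rintro rfl; simp at hv
    obtain ⟨i, hi⟩ := Function.ne_iff.1 hu
    refine ⟨i, ?_⟩
    have h2 := congrFun h1 i
    rw [mulVec_diagonal, Pi.smul_apply, smul_eq_mul] at h2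
    exact mul_right_cancel₀ hi h2
  · rintro ⟨i, rfl⟩
    refine ⟨X *ᵥ Pi.single i 1, ?_, ?_⟩
    · intro h0
      have h1 : (Pi.single i 1 : Fin k → ℝ) = 0 := hinj (by simpa using h0)
      have := congrFun h1 i
      simp at this
    · rw [mulVec_mulVec, h, ← mulVec_mulVec, ← mulVec_smul]
      congr 1
      ext j
      rw [mulVec_diagonal]
      by_cases hj : j = i
      · subst hj; simp
      · simp [hj]

lemma lamMin_le (hX : IsUnit X) (h : N * X = X * diagonal f) (i : Fin k) : lamMin N ≤ f i := by
  rw [lamMin, eigenvalues_eq_range hX h]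
  exact csInf_le (Set.finite_range f).bddBelow ⟨i, rfl⟩

lemma le_lamMax (hX : IsUnit X) (h : N * X = X * diagonal f) (i : Fin k) : f i ≤ lamMax N := by
  rw [lamMax, eigenvalues_eq_range hX h]
  exact le_csSup (Set.finite_range f).bddAbove ⟨i, rfl⟩

lemma exists_eq_lamMin (hk : 0 < k) (hX : IsUnit X) (h : N * X = X * diagonal f) :
    ∃ i, f i = lamMin N := by
  have : Nonempty (Fin k) := ⟨⟨0, hk⟩⟩
  rw [lamMin, eigenvalues_eq_range hX h]
  exact (Set.range_nonempty f).csInf_mem (Set.finite_range f)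

lemma toC_mul {p q r : Type*} [Fintype q] (A : Matrix p q ℝ) (B : Matrix q r ℝ) :
    toC (A * B) = toC A * toC B := Matrix.map_mul

lemma toC_one {p : Type*} [DecidableEq p] : toC (1 : Matrix p p ℝ) = 1 := by
  simp [toC]

lemma nsq_toC_mulVec {p q : Type*} [Fintype p] [Fintype q] (E : Matrix p q ℝ) (w : q → ℂ) :
    star w ⬝ᵥ (toC (Eᵀ * E) *ᵥ w) = (nsq (toC E *ᵥ w) : ℂ) := by
  rw [toC_mul, ← mulVec_mulVec, star_dotProduct_toC_mulVec, transpose_transpose,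
    star_dotProduct_self]

lemma dotProduct_toC_diagonal {p : Type*} [Fintype p] [DecidableEq p] (h : p → ℝ) (u : p → ℂ) :
    (star u ⬝ᵥ (toC (diagonal h) *ᵥ u)).re = ∑ i, h i * Complex.normSq (u i) := by
  have : toC (diagonal h) = diagonal (fun i => (h i : ℂ)) := by
    ext i j
    by_cases hij : i = j
    · subst hij; simp [toC]
    · simp [toC, hij]
  rw [this, dotProduct, Complex.re_sum]
  refine Finset.sum_congr rfl fun i _ => ?_
  rw [mulVec_diagonal]
  simp [Complex.normSq_apply]
  ring

/-- Rayleigh quotient bounds for the pencil `(H, M)`, in coordinates `Z` in which `M` is the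
identity. -/
lemma rayleigh (hk : 0 < k) {M H Z : Matrix (Fin k) (Fin k) ℝ} (hZ : Zᵀ * M * Z = 1)
    (hH : H.IsHermitian) :
    (∀ w : Fin k → ℂ, lamMin (M⁻¹ * H) * nsq w ≤ (star w ⬝ᵥ (toC (Zᵀ * H * Z) *ᵥ w)).re ∧
      (star w ⬝ᵥ (toC (Zᵀ * H * Z) *ᵥ w)).re ≤ lamMax (M⁻¹ * H) * nsq w) ∧
    lamMin (M⁻¹ * H) ≤ lamMax (M⁻¹ * H) ∧ (H.PosSemidef → 0 ≤ lamMin (M⁻¹ * H)) := by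
  have hH' : (Zᵀ * H * Z).IsHermitian := by
    have := isHermitian_conjTranspose_mul_mul Z hH
    rwa [conjTranspose_eq_transpose_of_trivial] at this
  obtain ⟨U, h, hU, hd⟩ := exists_orthogonal_diagonalization hH'
  have hU' : U * Uᵀ = 1 := mul_eq_one_comm.1 hU
  have hUu : IsUnit U := IsUnit.of_mul_eq_one_right _ hU
  have hX : IsUnit (Z * U) := (isUnit_of_congruent_one hZ).mul hUu
  have hdiag : (M⁻¹ * H) * (Z * U) = (Z * U) * diagonal h := by
    rw [inv_of_congruent_one hZ, ← hd]
    calc Z * Zᵀ * H * (Z * U) = Z * 1 * (Zᵀ * H * Z) * U := by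
          simp only [Matrix.mul_assoc, Matrix.mul_one]
      _ = Z * (U * Uᵀ) * (Zᵀ * H * Z) * U := by rw [hU']
      _ = _ := by simp only [Matrix.mul_assoc]
  refine ⟨fun w => ?_, ?_, fun hp => ?_⟩
  · obtain ⟨u, rfl⟩ : ∃ u, w = toC U *ᵥ u := ⟨toC Uᵀ *ᵥ w, by
      rw [mulVec_mulVec, ← toC_mul, hU', toC_one, one_mulVec]⟩
    have e1 : nsq (toC U *ᵥ u) = nsq u := by
      have := nsq_toC_mulVec U u
      rw [hU, toC_one, one_mulVec, star_dotProduct_self] at this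
      exact_mod_cast this.symm
    have e2 : (star (toC U *ᵥ u) ⬝ᵥ (toC (Zᵀ * H * Z) *ᵥ (toC U *ᵥ u))).re =
        ∑ i, h i * Complex.normSq (u i) := by
      rw [← dotProduct_toC_diagonal, ← hd]
      have := star_dotProduct_toC_mulVec Uᵀ u (toC (Zᵀ * H * Z) *ᵥ (toC U *ᵥ u))
      rw [transpose_transpose] at this
      rw [← this, mulVec_mulVec, mulVec_mulVec, ← toC_mul, ← toC_mul]
    rw [e1, e2, nsq, Finset.mul_sum, Finset.mul_sum]
    constructor
    · exact Finset.sum_le_sum fun i _ =>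
        mul_le_mul_of_nonneg_right (lamMin_le hX hdiag i) (Complex.normSq_nonneg _)
    · exact Finset.sum_le_sum fun i _ =>
        mul_le_mul_of_nonneg_right (le_lamMax hX hdiag i) (Complex.normSq_nonneg _)
  · exact (lamMin_le hX hdiag ⟨0, hk⟩).trans (le_lamMax hX hdiag ⟨0, hk⟩)
  · obtain ⟨i, hi⟩ := exists_eq_lamMin hk hX hdiag
    rw [← hi]
    have h1 := (hp.conjTranspose_mul_mul_same Z).conjTranspose_mul_mul_same U
    rw [conjTranspose_eq_transpose_of_trivial, conjTranspose_eq_transpose_of_trivial, hd] at h1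
    simpa using h1.diag_nonneg (i := i)

end Extreme

/-! ### Block matrices -/

section Block

variable {n m l : ℕ}

lemma block3_mul
    (A₁₁ A₁₁' : Matrix (Fin n) (Fin n) ℝ) (A₁₂ A₁₂' : Matrix (Fin n) (Fin m) ℝ)
    (A₁₃ A₁₃' : Matrix (Fin n) (Fin l) ℝ)
    (A₂₁ A₂₁' : Matrix (Fin m) (Fin n) ℝ) (A₂₂ A₂₂' : Matrix (Fin m) (Fin m) ℝ)
    (A₂₃ A₂₃' : Matrix (Fin m) (Fin l) ℝ)
    (A₃₁ A₃₁' : Matrix (Fin l) (Fin n) ℝ) (A₃₂ A₃₂' : Matrix (Fin l) (Fin m) ℝ)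
    (A₃₃ A₃₃' : Matrix (Fin l) (Fin l) ℝ) :
    block3 A₁₁ A₁₂ A₁₃ A₂₁ A₂₂ A₂₃ A₃₁ A₃₂ A₃₃ *
      block3 A₁₁' A₁₂' A₁₃' A₂₁' A₂₂' A₂₃' A₃₁' A₃₂' A₃₃' =
    block3 (A₁₁ * A₁₁' + A₁₂ * A₂₁' + A₁₃ * A₃₁') (A₁₁ * A₁₂' + A₁₂ * A₂₂' + A₁₃ * A₃₂')
      (A₁₁ * A₁₃' + A₁₂ * A₂₃' + A₁₃ * A₃₃')
      (A₂₁ * A₁₁' + A₂₂ * A₂₁' + A₂₃ * A₃₁') (A₂₁ * A₁₂' + A₂₂ * A₂₂' + A₂₃ * A₃₂')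
      (A₂₁ * A₁₃' + A₂₂ * A₂₃' + A₂₃ * A₃₃')
      (A₃₁ * A₁₁' + A₃₂ * A₂₁' + A₃₃ * A₃₁') (A₃₁ * A₁₂' + A₃₂ * A₂₂' + A₃₃ * A₃₂')
      (A₃₁ * A₁₃' + A₃₂ * A₂₃' + A₃₃ * A₃₃') := by
  ext (i | i | i) (j | j | j) <;>
    simp [block3, Matrix.mul_apply, Fintype.sum_sum_type, add_assoc]

lemma block3_transpose
    (A₁₁ : Matrix (Fin n) (Fin n) ℝ) (A₁₂ : Matrix (Fin n) (Fin m) ℝ)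
    (A₁₃ : Matrix (Fin n) (Fin l) ℝ)
    (A₂₁ : Matrix (Fin m) (Fin n) ℝ) (A₂₂ : Matrix (Fin m) (Fin m) ℝ)
    (A₂₃ : Matrix (Fin m) (Fin l) ℝ)
    (A₃₁ : Matrix (Fin l) (Fin n) ℝ) (A₃₂ : Matrix (Fin l) (Fin m) ℝ)
    (A₃₃ : Matrix (Fin l) (Fin l) ℝ) :
    (block3 A₁₁ A₁₂ A₁₃ A₂₁ A₂₂ A₂₃ A₃₁ A₃₂ A₃₃)ᵀ =
      block3 A₁₁ᵀ A₂₁ᵀ A₃₁ᵀ A₁₂ᵀ A₂₂ᵀ A₃₂ᵀ A₁₃ᵀ A₂₃ᵀ A₃₃ᵀ := by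
  ext (i | i | i) (j | j | j) <;> simp [block3]

lemma toC_block3_mulVec
    (A₁₁ : Matrix (Fin n) (Fin n) ℝ) (A₁₂ : Matrix (Fin n) (Fin m) ℝ)
    (A₁₃ : Matrix (Fin n) (Fin l) ℝ)
    (A₂₁ : Matrix (Fin m) (Fin n) ℝ) (A₂₂ : Matrix (Fin m) (Fin m) ℝ)
    (A₂₃ : Matrix (Fin m) (Fin l) ℝ)
    (A₃₁ : Matrix (Fin l) (Fin n) ℝ) (A₃₂ : Matrix (Fin l) (Fin m) ℝ)
    (A₃₃ : Matrix (Fin l) (Fin l) ℝ) (x : Fin n → ℂ) (y : Fin m → ℂ) (w : Fin l → ℂ) :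
    toC (block3 A₁₁ A₁₂ A₁₃ A₂₁ A₂₂ A₂₃ A₃₁ A₃₂ A₃₃) *ᵥ Sum.elim x (Sum.elim y w) =
      Sum.elim (toC A₁₁ *ᵥ x + toC A₁₂ *ᵥ y + toC A₁₃ *ᵥ w)
        (Sum.elim (toC A₂₁ *ᵥ x + toC A₂₂ *ᵥ y + toC A₂₃ *ᵥ w)
          (toC A₃₁ *ᵥ x + toC A₃₂ *ᵥ y + toC A₃₃ *ᵥ w)) := by
  ext (i | i | i) <;>
    simp [block3, mulVec, dotProduct, Fintype.sum_sum_type, add_assoc]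

lemma block3_one : block3 (1 : Matrix (Fin n) (Fin n) ℝ) 0 0 0 (1 : Matrix (Fin m) (Fin m) ℝ) 0
    0 0 (1 : Matrix (Fin l) (Fin l) ℝ) = 1 := by
  simp [block3]

end Block

/-! ### The generalized eigenvalue problem in normalized coordinates -/

section Pencil

variable {n m l : ℕ}

/-- `z` is an eigenvalue of the matrix pencil `K - z M`. -/
def IsPencilEigenvalue {ι : Type*} [Fintype ι] (K M : Matrix ι ι ℝ) (z : ℂ) : Prop :=
  ∃ v : ι → ℂ, v ≠ 0 ∧ toC K *ᵥ v = z • (toC M *ᵥ v)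

lemma isPencilEigenvalue_iff_det {ι : Type*} [Fintype ι] [DecidableEq ι] {K M : Matrix ι ι ℝ}
    {z : ℂ} : IsPencilEigenvalue K M z ↔ (toC K - z • toC M).det = 0 := by
  rw [← exists_mulVec_eq_zero_iff]
  simp only [IsPencilEigenvalue, sub_mulVec, smul_mulVec, sub_eq_zero]

lemma IsPencilEigenvalue.transpose {ι : Type*} [Fintype ι] [DecidableEq ι] {K M : Matrix ι ι ℝ}
    {z : ℂ} (h : IsPencilEigenvalue K M z) : IsPencilEigenvalue Kᵀ Mᵀ z := by
  rw [isPencilEigenvalue_iff_det] at h ⊢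
  rw [← det_transpose] at h
  exact h

/-- Eigenvalues of a pencil are invariant under congruence. -/
lemma IsPencilEigenvalue.congruence {ι : Type*} [Fintype ι] [DecidableEq ι]
    {K M : Matrix ι ι ℝ} {z : ℂ} (h : IsPencilEigenvalue K M z)
    (Q : Matrix ι ι ℝ) :
    IsPencilEigenvalue (Qᵀ * K * Q) (Qᵀ * M * Q) z := by
  rw [isPencilEigenvalue_iff_det] at h ⊢
  have : toC (Qᵀ * K * Q) - z • toC (Qᵀ * M * Q) = toC Qᵀ * (toC K - z • toC M) * toC Q := by
    rw [toC_mul, toC_mul, toC_mul, toC_mul, Matrix.mul_sub, Matrix.sub_mul, Matrix.mul_smul,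
      Matrix.smul_mul]
  rw [this, det_mul, det_mul, h]
  simp

/-- The coefficient matrix in normalized coordinates. -/
def normK (a : Fin n → ℝ) (B : Matrix (Fin m) (Fin n) ℝ) (C : Matrix (Fin l) (Fin m) ℝ)
    (d : Fin l → ℝ) : Matrix (Fin n ⊕ Fin m ⊕ Fin l) (Fin n ⊕ Fin m ⊕ Fin l) ℝ :=
  block3 (diagonal a) Bᵀ 0 B 0 Cᵀ 0 C (diagonal d)

/-- The preconditioner with switches `e, f, c` in normalized coordinates: the product
`L(e B, -c C) diag(1, -1, 1) R(f Bᵀ, -c Cᵀ)`. -/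
def normM (B : Matrix (Fin m) (Fin n) ℝ) (C : Matrix (Fin l) (Fin m) ℝ) (e f c : ℝ) :
    Matrix (Fin n ⊕ Fin m ⊕ Fin l) (Fin n ⊕ Fin m ⊕ Fin l) ℝ :=
  block3 1 (f • Bᵀ) 0 (e • B) ((e * f) • (B * Bᵀ) - 1) (c • Cᵀ) 0 (c • C) (1 - c ^ 2 • (C * Cᵀ))

lemma normK_transpose (a : Fin n → ℝ) (B : Matrix (Fin m) (Fin n) ℝ)
    (C : Matrix (Fin l) (Fin m) ℝ) (d : Fin l → ℝ) : (normK a B C d)ᵀ = normK a B C d := by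
  simp [normK, block3_transpose]

lemma normM_transpose (B : Matrix (Fin m) (Fin n) ℝ)
    (C : Matrix (Fin l) (Fin m) ℝ) (e f c : ℝ) : (normM B C e f c)ᵀ = normM B C f e c := by
  simp [normM, block3_transpose, mul_comm e f]

lemma toC_smul {p q : Type*} (r : ℝ) (A : Matrix p q ℝ) : toC (r • A) = (r : ℂ) • toC A := by
  ext i j; simp [toC]

lemma toC_sub {p q : Type*} (A B : Matrix p q ℝ) : toC (A - B) = toC A - toC B := by
  ext i j; simp [toC]

lemma toC_diagonal_mulVec {p : Type*} [Fintype p] [DecidableEq p] (h : p → ℝ) (u : p → ℂ) :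
    toC (diagonal h) *ᵥ u = fun i => (h i : ℂ) * u i := by
  have : toC (diagonal h) = diagonal (fun i => (h i : ℂ)) := by
    ext i j
    by_cases hij : i = j
    · subst hij; simp [toC]
    · simp [toC, hij]
  funext i
  rw [this, mulVec_diagonal]

/-- The eigenvalue equations after multiplication of the eigenvector by the upper triangular
factor of the preconditioner. -/
lemma IsPencilEigenvalue.exists_equations {a : Fin n → ℝ} {B : Matrix (Fin m) (Fin n) ℝ}
    {C : Matrix (Fin l) (Fin m) ℝ} {d : Fin l → ℝ} {e f c : ℝ} {z : ℂ}
    (h : IsPencilEigenvalue (normK a B C d) (normM B C e f c) z) :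
    ∃ (x β γ R : Fin n → ℂ) (Y G : Fin m → ℂ) (W : Fin l → ℂ),
      (x ≠ 0 ∨ Y ≠ 0 ∨ W ≠ 0) ∧ β = toC Bᵀ *ᵥ Y ∧ G = toC Cᵀ *ᵥ W ∧ γ = toC Bᵀ *ᵥ G ∧
      (∀ i, z * x i = a i * x i + (1 - f * a i) * (β i + c * γ i)) ∧
      (∀ i, R i = -((1 - e * a i) * x i) + (e + f - e * f * a i) * (β i + c * γ i)) ∧
      z • Y = toC B *ᵥ R - G ∧
      ∀ j, z * W j = (toC C *ᵥ (Y + (2 * c : ℂ) • G - (c : ℂ) • (toC B *ᵥ R))) j + d j * W j := by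
  obtain ⟨v, hv, hKM⟩ := h
  obtain ⟨x₀, y₀, w, rfl⟩ : ∃ x₀ y₀ w, v = Sum.elim x₀ (Sum.elim y₀ w) :=
    ⟨v ∘ Sum.inl, v ∘ Sum.inr ∘ Sum.inl, v ∘ Sum.inr ∘ Sum.inr, by
      ext (i | i | i) <;> rfl⟩
  rw [normK, normM, toC_block3_mulVec, toC_block3_mulVec] at hKM
  have z0 : ∀ {p q : ℕ} (u : Fin q → ℂ), toC (0 : Matrix (Fin p) (Fin q) ℝ) *ᵥ u = 0 := by
    intro p q u; simp [toC]
  simp only [z0, toC_smul, toC_sub, toC_one, toC_mul, sub_mulVec, smul_mulVec, one_mulVec,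
    ← mulVec_mulVec, toC_diagonal_mulVec, add_zero, zero_add] at hKM
  have E1 : ∀ i, (a i : ℂ) * x₀ i + (toC Bᵀ *ᵥ y₀) i = z * (x₀ i + f * (toC Bᵀ *ᵥ y₀) i) :=
    fun i => by simpa using congrFun hKM (Sum.inl i)
  have E2 : toC B *ᵥ x₀ + toC Cᵀ *ᵥ w = z • ((e : ℂ) • (toC B *ᵥ x₀) +
      (((e * f : ℝ) : ℂ) • (toC B *ᵥ (toC Bᵀ *ᵥ y₀)) - y₀) + (c : ℂ) • (toC Cᵀ *ᵥ w)) := by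
    funext i; simpa using congrFun hKM (Sum.inr (Sum.inl i))
  have E3 : ∀ j, (toC C *ᵥ y₀) j + d j * w j = z * ((c : ℂ) * (toC C *ᵥ y₀) j +
      (w j - (c : ℂ) ^ 2 * (toC C *ᵥ (toC Cᵀ *ᵥ w)) j)) :=
    fun j => by simpa using congrFun hKM (Sum.inr (Sum.inr j))
  set G := toC Cᵀ *ᵥ w with hG
  set η := toC Bᵀ *ᵥ y₀ with hη
  set Y := y₀ - (c : ℂ) • G with hY
  have hy₀ : y₀ = Y + (c : ℂ) • G := by rw [hY]; simp
  have hηβ : η = toC Bᵀ *ᵥ Y + (c : ℂ) • (toC Bᵀ *ᵥ G) := by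
    rw [hη, hy₀, mulVec_add, mulVec_smul]
  have hηi : ∀ i, (toC Bᵀ *ᵥ Y) i + c * (toC Bᵀ *ᵥ G) i = η i := fun i => by
    rw [hηβ]; simp
  have hBR : z • Y = toC B *ᵥ (fun i => -((1 - e * a i) * (x₀ i + f * η i)) +
      (e + f - e * f * a i) * η i) - G := by
    have hR : (fun i => -((1 - e * a i) * (x₀ i + f * η i)) + (e + f - e * f * a i) * η i) =
        (z * e) • x₀ + (z * (e * f)) • η - x₀ := by
      funext i
      simp only [Pi.add_apply, Pi.sub_apply, Pi.smul_apply, smul_eq_mul]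
      linear_combination (e : ℂ) * E1 i
    rw [hR, mulVec_sub, mulVec_add, mulVec_smul, mulVec_smul]
    have : G = (toC B *ᵥ x₀ + G) - toC B *ᵥ x₀ := by simp
    rw [this, E2, hY]
    funext i
    simp only [Pi.add_apply, Pi.sub_apply, Pi.smul_apply, smul_eq_mul, Complex.ofReal_mul]
    ring
  refine ⟨fun i => x₀ i + f * η i, _, _, _, Y, G, w, ?_, rfl, rfl, rfl, ?_, ?_, hBR, ?_⟩
  · by_contra hcon
    push Not at hcon
    obtain ⟨h1, h2, h3⟩ := hcon
    have hG0 : G = 0 := by rw [hG, h3, mulVec_zero]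
    have hy0 : y₀ = 0 := by rw [hy₀, h2, hG0]; simp
    have hη0 : η = 0 := by rw [hη, hy0, mulVec_zero]
    have hx0 : x₀ = 0 := by
      funext i
      have := congrFun h1 i
      simpa [hη0] using this
    apply hv
    rw [hx0, hy0, h3]
    ext (i | i | i) <;> rfl
  · intro i
    simp only [hηi]
    linear_combination -(E1 i)
  · intro i
    simp only [hηi]
  · intro j
    have h1 : toC B *ᵥ (fun i => -((1 - e * a i) * (x₀ i + f * η i)) +
      (e + f - e * f * a i) * η i) = z • Y + G := by rw [hBR]; simp
    rw [h1]
    have h2 := E3 j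
    rw [hy₀] at h2
    simp only [mulVec_add, mulVec_sub, mulVec_smul, Pi.add_apply, Pi.sub_apply, Pi.smul_apply,
      smul_eq_mul] at h2 ⊢
    linear_combination -h2

/-- Symmetrization for the preconditioners with equal lower and upper factors. -/
lemma IsPencilEigenvalue.exists_reduced_symm {a : Fin n → ℝ} (ha : ∀ i, 0 < a i)
    {B : Matrix (Fin m) (Fin n) ℝ}
    {C : Matrix (Fin l) (Fin m) ℝ} {d : Fin l → ℝ} {e c : ℝ} {z : ℂ}
    (h : IsPencilEigenvalue (normK a B C d) (normM B C e e c) z) :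
    ∃ (Xp β γ : Fin n → ℂ) (Y G : Fin m → ℂ) (W : Fin l → ℂ),
      0 < nsq Xp + nsq (0 : Fin n → ℂ) + nsq Y + nsq W ∧
      ReducedEigen a (fun i => 1 - e * a i) 0 B C d c z Xp 0 β γ Y G W := by
  obtain ⟨x, β, γ, R, Y, G, W, hne, hβ, hG, hγ, hx, hR, hY, hW⟩ := h.exists_equations
  refine ⟨x, β, γ, Y, G, W, ?_, hβ, hG, hγ, ?_, by simp, R, ?_, hY, hW⟩
  · have h1 := nsq_nonneg x
    have h2 := nsq_nonneg Y
    have h3 := nsq_nonneg W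
    rw [nsq_zero]
    by_contra hcon
    rcases hne with hne | hne | hne
    · exact hne (nsq_eq_zero (by linarith))
    · exact hne (nsq_eq_zero (by linarith))
    · exact hne (nsq_eq_zero (by linarith))
  · intro i
    rw [hx]
    push_cast
    ring
  · intro i
    have hai : (a i : ℂ) ≠ 0 := by exact_mod_cast (ha i).ne'
    rw [hR]
    simp only [Pi.zero_apply]
    push_cast
    field_simp
    ring

/-- Symmetrization for the block triangular factor in the first two unknowns: `1 - a = qp² - qm²`
is absorbed by the weights `qp = √(1 - a)` and `qm = √(a - 1)` (one of which is `0`). In the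
degenerate case, where all weighted unknowns vanish, `z = 1` and the unweighted first unknown is
used; it may be counted as `Xp` or as `Xm`, as decided by `pos`. -/
lemma IsPencilEigenvalue.exists_reduced_triangular {a : Fin n → ℝ} (ha : ∀ i, 0 < a i)
    {B : Matrix (Fin m) (Fin n) ℝ}
    {C : Matrix (Fin l) (Fin m) ℝ} {d : Fin l → ℝ} {c : ℝ} {z : ℂ}
    (h : IsPencilEigenvalue (normK a B C d) (normM B C 1 0 c) z)
    (pos : Fin n → Prop) (hpos : ∀ i, pos i → a i ≤ 1) (hneg : ∀ i, ¬ pos i → 1 ≤ a i) :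
    ∃ (Xp Xm β γ : Fin n → ℂ) (Y G : Fin m → ℂ) (W : Fin l → ℂ),
      0 < nsq Xp + nsq Xm + nsq Y + nsq W ∧
      ReducedEigen a (fun i => √(1 - a i)) (fun i => √(a i - 1)) B C d c z Xp Xm β γ Y G W ∧
      (∀ i, pos i → Xm i = 0 ∧ √(a i - 1) = 0) ∧ ∀ i, ¬ pos i → Xp i = 0 ∧ √(1 - a i) = 0 := by
  classical
  obtain ⟨x, β, γ, R, Y, G, W, hne, hβ, hG, hγ, hx, hR, hY, hW⟩ := h.exists_equations
  have sq_sub : ∀ i, √(1 - a i) ^ 2 - √(a i - 1) ^ 2 = 1 - a i := by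
    intro i
    rcases le_total (a i) 1 with hi | hi
    · rw [Real.sqrt_eq_zero_of_nonpos (sub_nonpos.2 hi), Real.sq_sqrt (sub_nonneg.2 hi)]; ring
    · rw [Real.sqrt_eq_zero_of_nonpos (sub_nonpos.2 hi), Real.sq_sqrt (sub_nonneg.2 hi)]; ring
  have qm0 : ∀ i, pos i → √(a i - 1) = 0 := fun i hi =>
    Real.sqrt_eq_zero_of_nonpos (sub_nonpos.2 (hpos i hi))
  have qp0 : ∀ i, ¬ pos i → √(1 - a i) = 0 := fun i hi =>
    Real.sqrt_eq_zero_of_nonpos (sub_nonpos.2 (hneg i hi))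
  have hτ : ∀ i, (1 - √(1 - a i) ^ 2 + √(a i - 1) ^ 2) / a i = 1 := by
    intro i
    rw [div_eq_one_iff_eq (ha i).ne']
    linarith [sq_sub i]
  have sum_pos : ∀ {Xp Xm : Fin n → ℂ}, (Xp ≠ 0 ∨ Xm ≠ 0 ∨ Y ≠ 0 ∨ W ≠ 0) →
      0 < nsq Xp + nsq Xm + nsq Y + nsq W := by
    intro Xp Xm hX
    have h1 := nsq_nonneg Xp
    have h2 := nsq_nonneg Xm
    have h3 := nsq_nonneg Y
    have h4 := nsq_nonneg W
    by_contra hcon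
    rcases hX with hne | hne | hne | hne
    · exact hne (nsq_eq_zero (by linarith))
    · exact hne (nsq_eq_zero (by linarith))
    · exact hne (nsq_eq_zero (by linarith))
    · exact hne (nsq_eq_zero (by linarith))
  by_cases hdeg : (fun i => (√(1 - a i) : ℂ) * x i) ≠ 0 ∨
      (fun i => (√(a i - 1) : ℂ) * x i) ≠ 0 ∨ Y ≠ 0 ∨ W ≠ 0
  · refine ⟨fun i => √(1 - a i) * x i, fun i => √(a i - 1) * x i, β, γ, Y, G, W, sum_pos hdeg,
      ⟨hβ, hG, hγ, ?_, ?_, R, ?_, hY, hW⟩, ?_, ?_⟩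
    · intro i
      have := hx i
      simp only [Complex.ofReal_zero, zero_mul, sub_zero, one_mul] at this
      linear_combination (√(1 - a i) : ℂ) * this
    · intro i
      have := hx i
      simp only [Complex.ofReal_zero, zero_mul, sub_zero, one_mul] at this
      linear_combination (√(a i - 1) : ℂ) * this
    · intro i
      rw [hR, hτ]
      have h2 : ((√(1 - a i) : ℂ)) ^ 2 - (√(a i - 1) : ℂ) ^ 2 = 1 - a i := by
        exact_mod_cast sq_sub i
      push_cast
      linear_combination (x i) * h2
    · intro i hi
      simp [qm0 i hi]
    · intro i hi
      simp [qp0 i hi]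
  · push Not at hdeg
    obtain ⟨h1, h2, h3, h4⟩ := hdeg
    have hx0 : x ≠ 0 := by
      rcases hne with hne | hne | hne
      · exact hne
      · exact absurd h3 hne
      · exact absurd h4 hne
    have hG0 : G = 0 := by rw [hG, h4, mulVec_zero]
    have hβ0 : β = 0 := by rw [hβ, h3, mulVec_zero]
    have hγ0 : γ = 0 := by rw [hγ, hG0, mulVec_zero]
    have hR0 : ∀ i, R i = 0 := by
      intro i
      have e1 : (√(1 - a i) : ℂ) * x i = 0 := congrFun h1 i
      have e2 : (√(a i - 1) : ℂ) * x i = 0 := congrFun h2 i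
      have h2 : ((√(1 - a i) : ℂ)) ^ 2 - (√(a i - 1) : ℂ) ^ 2 = 1 - a i := by
        exact_mod_cast sq_sub i
      rw [hR, hβ0, hγ0]
      simp only [Complex.ofReal_one, one_mul, Pi.zero_apply, mul_zero, add_zero]
      linear_combination (x i) * h2 - (√(1 - a i) : ℂ) * e1 + (√(a i - 1) : ℂ) * e2
    refine ⟨fun i => if pos i then x i else 0, fun i => if pos i then 0 else x i, β, γ, Y, G, W,
      sum_pos ?_, ⟨hβ, hG, hγ, ?_, ?_, R, ?_, hY, hW⟩, ?_, ?_⟩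
    · obtain ⟨i, hi⟩ := Function.ne_iff.1 hx0
      by_cases hp : pos i
      · exact Or.inl (Function.ne_iff.2 ⟨i, by simpa [hp] using hi⟩)
      · exact Or.inr (Or.inl (Function.ne_iff.2 ⟨i, by simpa [hp] using hi⟩))
    · intro i
      have := hx i
      rw [hβ0, hγ0] at this ⊢
      by_cases hp : pos i
      · simpa [hp] using this
      · simp [hp]
    · intro i
      have := hx i
      rw [hβ0, hγ0] at this ⊢
      by_cases hp : pos i
      · simp [hp]
      · simpa [hp] using this
    · intro i
      have e1 : (√(1 - a i) : ℂ) * x i = 0 := congrFun h1 i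
      have e2 : (√(a i - 1) : ℂ) * x i = 0 := congrFun h2 i
      rw [hR0, hβ0, hγ0]
      by_cases hp : pos i <;> simp only [hp, if_true, if_false, e1, e2] <;> simp
    · intro i hi
      exact ⟨by simp [hi], qm0 i hi⟩
    · intro i hi
      exact ⟨by simp [hi], qp0 i hi⟩

end Pencil

/-! ### Reduction of the preconditioned matrices to the normal form -/

namespace Precond

/-- `1` if the factor `L(E, ·)` occurs in the preconditioner, otherwise `0`. -/
def lowerSwitch : Precond → ℝ
  | .d | .ut | .f2 | .f3 => 0
  | .lt | .f1 | .f4 | .f5 => 1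

/-- `1` if the factor `R(Eᵀ, ·)` occurs in the preconditioner, otherwise `0`. -/
def upperSwitch : Precond → ℝ
  | .d | .lt | .f2 | .f4 => 0
  | .ut | .f1 | .f3 | .f5 => 1

/-- `1` if the factors `L(·, F)` and `R(·, Fᵀ)` occur in the preconditioner, otherwise `0`. -/
def schurSwitch : Precond → ℝ
  | .d | .ut | .lt | .f1 => 0
  | .f2 | .f3 | .f4 | .f5 => 1

end Precond

open Precond

namespace BlockData

variable {n m l : ℕ} (P : BlockData n m l)

lemma precond_eq (k : Precond) : P.precond k =
    lowerFactor (k.lowerSwitch • (P.B * P.MA⁻¹)) (-(k.schurSwitch • (P.C * P.Shat⁻¹))) *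
      P.diagFactor *
      upperFactor (k.upperSwitch • (P.MA⁻¹ * P.Bᵀ)) (-(k.schurSwitch • (P.Shat⁻¹ * P.Cᵀ))) := by
  have h1 : (lowerFactor 0 0 : Matrix (Fin n ⊕ Fin m ⊕ Fin l) (Fin n ⊕ Fin m ⊕ Fin l) ℝ) = 1 :=
    block3_one
  have h2 : (upperFactor 0 0 : Matrix (Fin n ⊕ Fin m ⊕ Fin l) (Fin n ⊕ Fin m ⊕ Fin l) ℝ) = 1 :=
    block3_one
  cases k <;> simp [precond, lowerSwitch, upperSwitch, schurSwitch, h1, h2]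

variable {P}

lemma precond_eq_block3 (hMA : IsUnit P.MA.det) (hS : IsUnit P.Shat.det) (k : Precond) :
    P.precond k = block3 P.MA (k.upperSwitch • P.Bᵀ) 0
      (k.lowerSwitch • P.B)
      ((k.lowerSwitch * k.upperSwitch) • (P.B * P.MA⁻¹ * P.Bᵀ) - P.Shat) (k.schurSwitch • P.Cᵀ)
      0 (k.schurSwitch • P.C) (P.MShat - k.schurSwitch ^ 2 • (P.C * P.Shat⁻¹ * P.Cᵀ)) := by
  have h1 : P.Shat * (P.Shat⁻¹ * P.Cᵀ) = P.Cᵀ := mul_nonsing_inv_cancel_left _ _ hS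
  have h2 : P.C * P.Shat⁻¹ * P.Shat = P.C := nonsing_inv_mul_cancel_right _ _ hS
  have h3 : P.MA * (P.MA⁻¹ * P.Bᵀ) = P.Bᵀ := mul_nonsing_inv_cancel_left _ _ hMA
  have h4 : P.B * P.MA⁻¹ * P.MA = P.B := nonsing_inv_mul_cancel_right _ _ hMA
  rw [precond_eq, lowerFactor, upperFactor, diagFactor, block3_mul, block3_mul]
  simp only [Matrix.one_mul, Matrix.mul_one, Matrix.zero_mul, Matrix.mul_zero, add_zero, zero_add,
    Matrix.smul_mul, Matrix.mul_smul, Matrix.neg_mul, Matrix.mul_neg, neg_neg, h1, h2, h3, h4,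
    neg_zero, smul_smul, sq]
  congr 1 <;> simp [Matrix.mul_assoc, sub_eq_add_neg, add_comm, mul_comm k.upperSwitch]

lemma isUnit_det_precond (hMA : IsUnit P.MA.det) (hS : IsUnit P.Shat.det)
    (hMS : IsUnit P.MShat.det) (k : Precond) : IsUnit (P.precond k).det := by
  rw [precond_eq, det_mul, det_mul]
  have h1 : ∀ U V, (lowerFactor U V :
      Matrix (Fin n ⊕ Fin m ⊕ Fin l) (Fin n ⊕ Fin m ⊕ Fin l) ℝ).det = 1 := by
    intro U V
    simp [lowerFactor, block3]
  have h2 : ∀ U V, (upperFactor U V :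
      Matrix (Fin n ⊕ Fin m ⊕ Fin l) (Fin n ⊕ Fin m ⊕ Fin l) ℝ).det = 1 := by
    intro U V
    simp [upperFactor, block3]
  rw [h1, h2, one_mul, mul_one]
  have : P.diagFactor.det = P.MA.det * ((-P.Shat).det * P.MShat.det) := by
    simp only [diagFactor, block3, fromCols_zero, fromRows_zero, det_fromBlocks_zero₁₂]
  rw [this, det_neg]
  exact hMA.mul (((isUnit_one.neg.pow _).mul hS).mul hMS)

lemma isPencilEigenvalue_of_mem (hMA : IsUnit P.MA.det) (hS : IsUnit P.Shat.det)
    (hMS : IsUnit P.MShat.det) {k : Precond} {z : ℂ} (hz : z ∈ P.eigenvalues k) :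
    IsPencilEigenvalue P.K (P.precond k) z := by
  obtain ⟨v, hv, h⟩ := hasEigenvalue_toLin'_iff.1 hz
  refine ⟨v, hv, ?_⟩
  have h1 : toC ((P.precond k)⁻¹ * P.K) *ᵥ v = z • v := h
  rw [← mulVec_smul, ← h1, mulVec_mulVec, ← toC_mul,
    mul_nonsing_inv_cancel_left _ _ (isUnit_det_precond hMA hS hMS k)]

/-- Coordinates in which `M_A`, `Ŝ`, `M̂_S` are identity matrices, `A = diag a` and `D = diag d`,
together with the meaning of the extreme eigenvalues of `P` in these coordinates. -/
structure NormalForm (P : BlockData n m l) (a : Fin n → ℝ) (B : Matrix (Fin m) (Fin n) ℝ)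
    (C : Matrix (Fin l) (Fin m) ℝ) (d : Fin l → ℝ) : Prop where
  a_pos : ∀ i, 0 < a i
  muMin_le : ∀ i, P.muMin ≤ a i
  le_muMax : ∀ i, a i ≤ P.muMax
  exists_muMin : ∃ i, a i = P.muMin
  nu : ∀ y : Fin m → ℂ,
    P.nuMin * nsq y ≤ ∑ i, 1 / a i * Complex.normSq ((toC Bᵀ *ᵥ y) i) ∧
      ∑ i, 1 / a i * Complex.normSq ((toC Bᵀ *ᵥ y) i) ≤ P.nuMax * nsq y
  nuMin_nonneg : 0 ≤ P.nuMin
  nuMin_le_nuMax : P.nuMin ≤ P.nuMax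
  omega : ∀ w : Fin l → ℂ, P.omegaMin * nsq w ≤ nsq (toC Cᵀ *ᵥ w) ∧
    nsq (toC Cᵀ *ᵥ w) ≤ P.omegaMax * nsq w
  omegaMin_nonneg : 0 ≤ P.omegaMin
  omegaMin_le_omegaMax : P.omegaMin ≤ P.omegaMax
  tau : ∀ w : Fin l → ℂ, P.tauMin * nsq w ≤ ∑ j, d j * Complex.normSq (w j) ∧
    ∑ j, d j * Complex.normSq (w j) ≤ P.tauMax * nsq w
  tauMin_nonneg : 0 ≤ P.tauMin
  tauMin_le_tauMax : P.tauMin ≤ P.tauMax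
  theta : ∀ w : Fin l → ℂ,
    P.thetaMin * nsq w ≤ ∑ j, d j * Complex.normSq (w j) + nsq (toC Cᵀ *ᵥ w) ∧
      ∑ j, d j * Complex.normSq (w j) + nsq (toC Cᵀ *ᵥ w) ≤ P.thetaMax * nsq w
  thetaMin_nonneg : 0 ≤ P.thetaMin
  kappa₁ : ∀ i, a i * (1 - a i) ≤ P.kappa₁
  kappa₂ : ∀ i, (1 - a i) ^ 2 * a i ≤ P.kappa₂
  pencil : ∀ k : Precond, ∀ z ∈ P.eigenvalues k,
    IsPencilEigenvalue (normK a B C d)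
      (normM B C k.lowerSwitch k.upperSwitch k.schurSwitch) z

theorem exists_normalForm (hn : 0 < n) (hm : 0 < m) (hl : 0 < l)
    (hA : P.A.PosDef) (hD : P.D.PosSemidef)
    (hMA : P.MA.PosDef) (hS : P.Shat.PosDef) (hMS : P.MShat.PosDef) :
    ∃ a B C d, NormalForm P a B C d := by
  obtain ⟨X, a, hX, hXA⟩ := exists_simultaneous_diagonalization hMA hA.1
  obtain ⟨Y, hY⟩ := exists_congruent_one hS
  obtain ⟨Z, d, hZ, hZD⟩ := exists_simultaneous_diagonalization hMS hD.1
  have hXu := isUnit_of_congruent_one hX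
  have hMAi := inv_of_congruent_one hX
  have hSi := inv_of_congruent_one hY
  have ha : ∀ i, 0 < a i := by
    intro i
    have h1 := hA.conjTranspose_mul_mul_same (B := X) (mulVec_injective_iff_isUnit.2 hXu)
    rw [conjTranspose_eq_transpose_of_trivial, hXA] at h1
    simpa using h1.diag_pos (i := i)
  have hAi : P.A⁻¹ = X * diagonal (fun i => 1 / a i) * Xᵀ := by
    refine inv_eq_left_inv ?_
    have h1 : diagonal (fun i => 1 / a i) * (Xᵀ * P.A * X) = 1 := by
      rw [hXA, diagonal_mul_diagonal, ← diagonal_one]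
      congr 1
      funext i
      exact one_div_mul_cancel (ha i).ne'
    have h2 := mul_eq_one_comm.1 (show (diagonal (fun i => 1 / a i) * Xᵀ * P.A) * X = 1 by
      rw [← h1]; simp only [Matrix.mul_assoc])
    rw [← h2]; simp only [Matrix.mul_assoc]
  have hT : P.MA⁻¹ * P.A * X = X * diagonal a := by
    rw [hMAi, ← hXA]; simp only [Matrix.mul_assoc]
  have hT1 : (1 - P.MA⁻¹ * P.A) * X = X * diagonal (fun i => 1 - a i) := by
    have : diagonal (fun i => 1 - a i) = 1 - diagonal a := by
      rw [← diagonal_one, diagonal_sub]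
    rw [this, Matrix.sub_mul, Matrix.mul_sub, hT, Matrix.one_mul, Matrix.mul_one]
  have hk1 : P.MA⁻¹ * P.A * (1 - P.MA⁻¹ * P.A) * X = X * diagonal (fun i => a i * (1 - a i)) := by
    rw [Matrix.mul_assoc, hT1, ← Matrix.mul_assoc, hT, Matrix.mul_assoc, diagonal_mul_diagonal]
  have hk2 : (1 - P.MA⁻¹ * P.A) ^ 2 * (P.MA⁻¹ * P.A) * X =
      X * diagonal (fun i => (1 - a i) ^ 2 * a i) := by
    rw [Matrix.mul_assoc, hT, ← Matrix.mul_assoc, sq, Matrix.mul_assoc (1 - P.MA⁻¹ * P.A), hT1,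
      ← Matrix.mul_assoc, hT1, Matrix.mul_assoc, Matrix.mul_assoc, diagonal_mul_diagonal,
      diagonal_mul_diagonal]
    congr 2
    funext i
    ring
  -- `B`, `C` and the Schur complements in normalized coordinates
  set B := Yᵀ * P.B * X with hB
  set C := Zᵀ * P.C * Y with hC
  have hBt : Bᵀ = Xᵀ * P.Bᵀ * Y := by
    rw [hB, transpose_mul, transpose_mul, transpose_transpose]; simp only [Matrix.mul_assoc]
  have hCt : Cᵀ = Yᵀ * P.Cᵀ * Z := by
    rw [hC, transpose_mul, transpose_mul, transpose_transpose]; simp only [Matrix.mul_assoc]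
  have hSP : P.S.PosSemidef := by
    have := hA.inv.posSemidef.mul_mul_conjTranspose_same P.B
    rwa [conjTranspose_eq_transpose_of_trivial] at this
  have hWP : (P.C * P.Shat⁻¹ * P.Cᵀ).PosSemidef := by
    have := hS.inv.posSemidef.mul_mul_conjTranspose_same P.C
    rwa [conjTranspose_eq_transpose_of_trivial] at this
  have hTP := hD.add hWP
  have hS' : Yᵀ * P.S * Y = B * diagonal (fun i => 1 / a i) * Bᵀ := by
    rw [S, hAi, hB, hBt]; simp only [Matrix.mul_assoc]
  have hW' : Zᵀ * (P.C * P.Shat⁻¹ * P.Cᵀ) * Z = Cᵀᵀ * Cᵀ := by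
    rw [transpose_transpose, hSi, hC, hCt]; simp only [Matrix.mul_assoc]
  have hT' : Zᵀ * (P.D + P.C * P.Shat⁻¹ * P.Cᵀ) * Z = diagonal d + Cᵀᵀ * Cᵀ := by
    rw [Matrix.mul_add, Matrix.add_mul, hW', hZD]
  obtain ⟨nu1, nu2, nu3⟩ := rayleigh hm hY hSP.1
  obtain ⟨om1, om2, om3⟩ := rayleigh hl hZ hWP.1
  obtain ⟨ta1, ta2, ta3⟩ := rayleigh hl hZ hD.1
  obtain ⟨th1, th2, th3⟩ := rayleigh hl hZ hTP.1
  rw [hS'] at nu1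
  rw [hW'] at om1
  rw [hZD] at ta1
  rw [hT'] at th1
  have hom : P.MShat⁻¹ * (P.C * P.Shat⁻¹ * P.Cᵀ) = P.MShat⁻¹ * P.C * P.Shat⁻¹ * P.Cᵀ := by
    simp only [Matrix.mul_assoc]
  rw [hom] at om1 om2 om3
  have hnu : ∀ y : Fin m → ℂ, (star y ⬝ᵥ (toC (B * diagonal (fun i => 1 / a i) * Bᵀ) *ᵥ y)).re =
      ∑ i, 1 / a i * Complex.normSq ((toC Bᵀ *ᵥ y) i) := by
    intro y
    rw [← dotProduct_toC_diagonal, toC_mul, toC_mul, ← mulVec_mulVec, ← mulVec_mulVec,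
      star_dotProduct_toC_mulVec]
  have hom' : ∀ w : Fin l → ℂ, (star w ⬝ᵥ (toC (Cᵀᵀ * Cᵀ) *ᵥ w)).re = nsq (toC Cᵀ *ᵥ w) := by
    intro w
    rw [nsq_toC_mulVec, Complex.ofReal_re]
  have hth' : ∀ w : Fin l → ℂ, (star w ⬝ᵥ (toC (diagonal d + Cᵀᵀ * Cᵀ) *ᵥ w)).re =
      ∑ j, d j * Complex.normSq (w j) + nsq (toC Cᵀ *ᵥ w) := by
    intro w
    have : toC (diagonal d + Cᵀᵀ * Cᵀ) = toC (diagonal d) + toC (Cᵀᵀ * Cᵀ) := by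
      ext i j
      exact Complex.ofReal_add _ _
    rw [this, add_mulVec, dotProduct_add, Complex.add_re, hom', dotProduct_toC_diagonal]
  have uMA : IsUnit P.MA.det := hMA.det_pos.ne'.isUnit
  have uS : IsUnit P.Shat.det := hS.det_pos.ne'.isUnit
  have uMS : IsUnit P.MShat.det := hMS.det_pos.ne'.isUnit
  refine ⟨a, B, C, d, ha, lamMin_le hXu hT, le_lamMax hXu hT, exists_eq_lamMin hn hXu hT,
    fun y => hnu y ▸ nu1 y, nu3 hSP, nu2, fun w => hom' w ▸ om1 w, om3 hWP, om2,
    fun w => dotProduct_toC_diagonal d w ▸ ta1 w, ta3 hD, ta2, fun w => hth' w ▸ th1 w, th3 hTP,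
    le_lamMax hXu hk1, le_lamMax hXu hk2, fun k z hz => ?_⟩
  have hp := (isPencilEigenvalue_of_mem uMA uS uMS hz).congruence (block3 X 0 0 0 Y 0 0 0 Z)
  have e1 : (block3 X 0 0 0 Y 0 0 0 Z)ᵀ * P.K * (block3 X 0 0 0 Y 0 0 0 Z) = normK a B C d := by
    rw [K, block3_transpose, block3_mul, block3_mul, normK, ← hXA, ← hZD, hBt, hCt, hB, hC]
    simp
  have e2 : (block3 X 0 0 0 Y 0 0 0 Z)ᵀ * P.precond k * (block3 X 0 0 0 Y 0 0 0 Z) =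
      normM B C k.lowerSwitch k.upperSwitch k.schurSwitch := by
    rw [precond_eq_block3 uMA uS, block3_transpose, block3_mul, block3_mul, normM, ← hX, ← hZ]
    have h1 : B * Bᵀ = Yᵀ * (P.B * P.MA⁻¹ * P.Bᵀ) * Y := by
      rw [hMAi, hB, hBt]; simp only [Matrix.mul_assoc]
    have h2 : C * Cᵀ = Zᵀ * (P.C * P.Shat⁻¹ * P.Cᵀ) * Z := by
      rw [hSi, hC, hCt]; simp only [Matrix.mul_assoc]
    rw [h1, h2, hBt, hCt, hB, hC]
    simp [Matrix.mul_sub, Matrix.sub_mul, hY]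
  rwa [e1, e2] at hp

end BlockData

/-! ### Bounds for the blocks in terms of the extreme eigenvalues -/

namespace BlockData.NormalForm

variable {n m l : ℕ} {P : BlockData n m l} {a : Fin n → ℝ} {B : Matrix (Fin m) (Fin n) ℝ}
  {C : Matrix (Fin l) (Fin m) ℝ} {d : Fin l → ℝ}

lemma muMin_pos (N : NormalForm P a B C d) : 0 < P.muMin := by
  obtain ⟨i, hi⟩ := N.exists_muMin
  exact hi ▸ N.a_pos i

lemma muMin_le_muMax (N : NormalForm P a B C d) : P.muMin ≤ P.muMax := by
  obtain ⟨i, -⟩ := N.exists_muMin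
  exact (N.muMin_le i).trans (N.le_muMax i)

lemma nuMax_nonneg (N : NormalForm P a B C d) : 0 ≤ P.nuMax :=
  N.nuMin_nonneg.trans N.nuMin_le_nuMax

lemma omegaMax_nonneg (N : NormalForm P a B C d) : 0 ≤ P.omegaMax :=
  N.omegaMin_nonneg.trans N.omegaMin_le_omegaMax

/-- `B diag(f) Bᵀ ≤ s ν̄` for `f ≤ s / a`, by comparison with `S = B diag(1 / a) Bᵀ`. -/
lemma sum_normSq_le (N : NormalForm P a B C d) {f : Fin n → ℝ} {s : ℝ} (hs : 0 ≤ s)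
    (hf : ∀ i, f i ≤ s / a i) (y : Fin m → ℂ) :
    ∑ i, f i * Complex.normSq ((toC Bᵀ *ᵥ y) i) ≤ s * P.nuMax * nsq y := by
  calc _ ≤ ∑ i, s * (1 / a i * Complex.normSq ((toC Bᵀ *ᵥ y) i)) := by
        refine Finset.sum_le_sum fun i _ => ?_
        rw [← mul_assoc, mul_one_div]
        exact mul_le_mul_of_nonneg_right (hf i) (Complex.normSq_nonneg _)
    _ = s * ∑ i, 1 / a i * Complex.normSq ((toC Bᵀ *ᵥ y) i) := by rw [Finset.mul_sum]
    _ ≤ s * (P.nuMax * nsq y) := mul_le_mul_of_nonneg_left (N.nu y).2 hs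
    _ = _ := by ring

lemma le_sum_normSq (N : NormalForm P a B C d) {f : Fin n → ℝ} {s : ℝ} (hs : 0 ≤ s)
    (hf : ∀ i, s / a i ≤ f i) (y : Fin m → ℂ) :
    s * P.nuMin * nsq y ≤ ∑ i, f i * Complex.normSq ((toC Bᵀ *ᵥ y) i) := by
  calc s * P.nuMin * nsq y = s * (P.nuMin * nsq y) := by ring
    _ ≤ s * ∑ i, 1 / a i * Complex.normSq ((toC Bᵀ *ᵥ y) i) :=
        mul_le_mul_of_nonneg_left (N.nu y).1 hs
    _ = ∑ i, s * (1 / a i * Complex.normSq ((toC Bᵀ *ᵥ y) i)) := by rw [Finset.mul_sum]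
    _ ≤ _ := by
        refine Finset.sum_le_sum fun i _ => ?_
        rw [← mul_assoc, mul_one_div]
        exact mul_le_mul_of_nonneg_right (hf i) (Complex.normSq_nonneg _)

lemma sum_normSq_comp_le (N : NormalForm P a B C d) {f : Fin n → ℝ} {s : ℝ} (hs : 0 ≤ s)
    (hf : ∀ i, f i ≤ s / a i) (w : Fin l → ℂ) :
    ∑ i, f i * Complex.normSq ((toC Bᵀ *ᵥ (toC Cᵀ *ᵥ w)) i) ≤
      s * P.nuMax * P.omegaMax * nsq w := by
  have h1 := N.nuMax_nonneg
  calc _ ≤ s * P.nuMax * nsq (toC Cᵀ *ᵥ w) := N.sum_normSq_le hs hf _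
    _ ≤ s * P.nuMax * (P.omegaMax * nsq w) := by
        gcongr
        exact (N.omega w).2
    _ = _ := by ring

lemma schur_lower_nonneg (N : NormalForm P a B C d) {t : ℝ} (ht : t ≤ 2) :
    0 ≤ P.hMin t + P.omegaMin * (1 - t) := by
  have h1 := N.omegaMin_nonneg
  have h2 := N.tauMin_nonneg
  have h3 := N.thetaMin_nonneg
  unfold hMin
  split_ifs with h
  · have := mul_nonneg h1 (sub_nonneg.2 h)
    linarith
  · have := mul_nonneg h1 (sub_nonneg.2 ht)
    linarith

/-- Bounds for `D + C (2 - T) Cᵀ` when `k₁ S ≤ T ≤ k₂ S`. For `k₂ ν̄ ≤ 1` the matrix is split as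
`(D + C Cᵀ) + C (1 - T) Cᵀ`, otherwise as `D + C (2 - T) Cᵀ`, so that the second summand is always
positive semidefinite. -/
lemma schur_bounds (N : NormalForm P a B C d) {f : Fin n → ℝ} {k₁ k₂ : ℝ} (h1 : 0 ≤ k₁)
    (h12 : k₁ ≤ k₂) (hf1 : ∀ i, k₁ / a i ≤ f i) (hf2 : ∀ i, f i ≤ k₂ / a i)
    (h2 : k₂ * P.nuMax ≤ 2) (w : Fin l → ℂ) :
    (P.hMin (k₂ * P.nuMax) + P.omegaMin * (1 - k₂ * P.nuMax)) * nsq w ≤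
      (∑ j, d j * Complex.normSq (w j)) + 2 * nsq (toC Cᵀ *ᵥ w) -
        ∑ i, f i * Complex.normSq ((toC Bᵀ *ᵥ (toC Cᵀ *ᵥ w)) i) ∧
    (∑ j, d j * Complex.normSq (w j)) + 2 * nsq (toC Cᵀ *ᵥ w) -
        ∑ i, f i * Complex.normSq ((toC Bᵀ *ᵥ (toC Cᵀ *ᵥ w)) i) ≤
      (P.hMax (k₂ * P.nuMax) + P.omegaMax * (1 - k₁ * P.nuMin)) * nsq w := by
  have l1 := N.le_sum_normSq h1 hf1 (toC Cᵀ *ᵥ w)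
  have u1 := N.sum_normSq_le (h1.trans h12) hf2 (toC Cᵀ *ᵥ w)
  obtain ⟨o1, o2⟩ := N.omega w
  obtain ⟨t1, t2⟩ := N.tau w
  obtain ⟨th1, th2⟩ := N.theta w
  have hle : k₁ * P.nuMin ≤ k₂ * P.nuMax :=
    mul_le_mul h12 N.nuMin_le_nuMax N.nuMin_nonneg (h1.trans h12)
  unfold hMin hMax
  split_ifs with h
  · have e1 := mul_le_mul_of_nonneg_left o1 (sub_nonneg.2 h)
    have e2 := mul_le_mul_of_nonneg_left o2 (sub_nonneg.2 (hle.trans h))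
    constructor <;> linarith
  · have e1 := mul_le_mul_of_nonneg_left o1 (sub_nonneg.2 h2)
    have e2 := mul_le_mul_of_nonneg_left o2 (sub_nonneg.2 (hle.trans h2))
    constructor <;> linarith

lemma abs_one_sub_le_sqrt_varrho {x s t : ℝ} (h1 : t ≤ x) (h2 : x ≤ s) :
    |1 - x| ≤ √(varrho s t) := by
  refine Real.abs_le_sqrt ?_
  unfold varrho
  rcases le_total x 1 with hx | hx
  · exact le_max_of_le_right (by nlinarith)
  · exact le_max_of_le_left (by nlinarith)

lemma varrho_nonneg (s t : ℝ) : 0 ≤ varrho s t := le_max_of_le_left (sq_nonneg _)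

/-- The coupling `C (I - T)` of the last two unknowns. -/
lemma coupling_bound (N : NormalForm P a B C d) {τ : Fin n → ℝ} {k₁ k₂ : ℝ} (h1 : 0 ≤ k₁)
    (h12 : k₁ ≤ k₂) (hf1 : ∀ i, k₁ / a i ≤ τ i) (hf2 : ∀ i, τ i ≤ k₂ / a i)
    (w : Fin l → ℂ) (y : Fin m → ℂ) :
    |(∑ k, (star ((toC Cᵀ *ᵥ w) k) * y k).im) -
        ∑ i, τ i * (star ((toC Bᵀ *ᵥ (toC Cᵀ *ᵥ w)) i) * (toC Bᵀ *ᵥ y) i).im| ≤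
      √(P.omegaMax * varrho (k₂ * P.nuMax) (k₁ * P.nuMin)) * (√(nsq w) * √(nsq y)) := by
  have key : ∀ v : Fin m → ℂ,
      |nsq v - ∑ i, τ i * Complex.normSq ((toC Bᵀ *ᵥ v) i)| ≤
        √(varrho (k₂ * P.nuMax) (k₁ * P.nuMin)) * nsq v := by
    intro v
    have l1 := N.le_sum_normSq h1 hf1 v
    have u1 := N.sum_normSq_le (h1.trans h12) hf2 v
    rcases (nsq_nonneg v).eq_or_lt with hv | hv
    · rw [nsq_eq_zero hv.symm]
      simp
    · set q := ∑ i, τ i * Complex.normSq ((toC Bᵀ *ᵥ v) i) with hq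
      have e : nsq v - q = (1 - q / nsq v) * nsq v := by field_simp
      rw [e, abs_mul, abs_of_pos hv]
      refine mul_le_mul_of_nonneg_right (abs_one_sub_le_sqrt_varrho ?_ ?_) hv.le
      · rwa [le_div_iff₀ hv]
      · rwa [div_le_iff₀ hv]
  refine (abs_im_form_le B τ (Real.sqrt_nonneg _) key _ _).trans ?_
  rw [mul_comm P.omegaMax, Real.sqrt_mul (varrho_nonneg _ _), mul_assoc, ← mul_assoc (√P.omegaMax),
    ← Real.sqrt_mul N.omegaMax_nonneg]
  gcongr
  exact (N.omega w).2

variable {qp qm : Fin n → ℝ} {z : ℂ} {Xp Xm β γ : Fin n → ℂ} {Y G : Fin m → ℂ} {W : Fin l → ℂ}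

/-- Bounds for the preconditioners without the factors containing `F`. An absent part `Xp` or `Xm`
leaves its bounds `lop, upp` or `lom, upm` free. -/
theorem bounds_uncoupled (N : NormalForm P a B C d)
    (hE : ReducedEigen a qp qm B C d 0 z Xp Xm β γ Y G W)
    (hne : 0 < nsq Xp + nsq Xm + nsq Y + nsq W)
    {lop upp lom upm k₁ k₂ σm κ ξm ηl ηu ρ : ℝ}
    (hp : ∀ i, (lop ≤ a i ∧ a i ≤ upp) ∨ (Xp i = 0 ∧ qp i = 0))
    (hm : ∀ i, (lom ≤ a i ∧ a i ≤ upm) ∨ (Xm i = 0 ∧ qm i = 0))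
    (hlop : 0 ≤ lop) (hlom : 0 ≤ lom) (hupp : 0 ≤ upp) (hupm : 0 ≤ upm)
    (hk1 : 0 ≤ k₁) (hk12 : k₁ ≤ k₂) (hk : ∀ i, k₁ ≤ 1 - qp i ^ 2 ∧ 1 - qp i ^ 2 ≤ k₂)
    (hκ0 : 0 ≤ κ) (hκ : ∀ i, a i * qp i ^ 2 ≤ κ)
    (hσ0 : 0 ≤ σm) (hσ : ∀ i, qm i ^ 2 ≤ σm * a i) (hξm : σm * P.nuMax = ξm)
    (hl1 : ηl ≤ lop) (hl2 : ηl ≤ P.tauMin)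
    (hl3 : ηl ≤ lom * g₁ ξm) (hl4 : ηl ≤ k₁ * P.nuMin * g₁ ξm)
    (hu1 : upp ≤ ηu) (hu2 : P.tauMax ≤ ηu)
    (hu3 : upm * g₂ ξm ≤ ηu) (hu4 : k₂ * P.nuMax * g₂ ξm ≤ ηu)
    (hρ : P.omegaMax + P.nuMax * κ ≤ ρ) :
    ηl ≤ z.re ∧ z.re ≤ ηu ∧ |z.im| ≤ √ρ := by
  have ha := N.a_pos
  have hβ := hE.hβ
  have hG := hE.hG
  have hν := N.nuMax_nonneg
  have hω := N.omegaMax_nonneg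
  have R := re_bounds (lw := P.tauMin) (uw := P.tauMax) (ly := k₁ * P.nuMin) (uy := k₂ * P.nuMax)
    (ξp := 0) (ξm := ξm) (ηl := ηl) (ηu := ηu) ha hE hne le_rfl (hξm ▸ mul_nonneg hσ0 hν) hp hm
    hlop hlom hupp hupm N.tauMin_nonneg (mul_nonneg hk1 N.nuMin_nonneg)
    (by simpa using N.tau W)
    (by
      rw [hβ]
      exact ⟨N.le_sum_normSq hk1 (fun i => div_le_div_of_nonneg_right (hk i).1 (ha i).le) Y,
        N.sum_normSq_le (hk1.trans hk12)
          (fun i => div_le_div_of_nonneg_right (hk i).2 (ha i).le) Y⟩)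
    (by simp)
    (by
      rw [hβ, ← hξm]
      refine N.sum_normSq_le hσ0 (fun i => ?_) Y
      have := ha i
      rw [div_pow, div_le_div_iff₀ (by positivity) this]
      calc qm i ^ 2 * a i ≤ σm * a i * a i := by gcongr; exact hσ i
        _ = _ := by ring)
    (by simpa [g₁_zero] using hl1) (by simpa [g₁_zero] using hl2) hl3 hl4
    (by simpa [g₂_zero] using hu1) (by simpa [g₂_zero] using hu2) hu3 hu4
  refine ⟨R.1, R.2, ?_⟩
  refine im_bound (p := κ * P.nuMax) (q := P.omegaMax) (r := 0) hE hne (mul_nonneg hκ0 hν) hω le_rfl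
    ?_ (by simp) ?_ (by linarith)
  · rw [hβ]
    refine N.sum_normSq_le hκ0 (fun i => ?_) Y
    rw [le_div_iff₀ (ha i), mul_comm]
    exact hκ i
  · have h1 := abs_im_sum_le (fun _ => (1 : ℝ)) G Y
    simp only [one_mul, one_pow] at h1
    rw [zero_mul, sub_zero]
    refine h1.trans ?_
    rw [← mul_assoc, ← Real.sqrt_mul hω]
    refine mul_le_mul_of_nonneg_right (Real.sqrt_le_sqrt ?_) (Real.sqrt_nonneg _)
    rw [hG]
    exact (N.omega W).2

/-- Bounds for the preconditioners with the factors containing `F`. The constants `k`, `s`, `t`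
enclose `1 - qp²`, `1 + qm²` and `1 - qp² + qm²`; divided by `a`, these are the weights in the Schur
complements of the blocks `(Xm, Y)` and `(Xp, W)` and in the second diagonal block `T`. -/
theorem bounds_coupled (N : NormalForm P a B C d)
    (hE : ReducedEigen a qp qm B C d 1 z Xp Xm β γ Y G W)
    (hne : 0 < nsq Xp + nsq Xm + nsq Y + nsq W)
    {lop upp lom upm k₁ k₂ s₁ s₂ t₁ t₂ σp σm κ κm ξp ξm ηl ηu ρ : ℝ}
    (hp : ∀ i, (lop ≤ a i ∧ a i ≤ upp) ∨ (Xp i = 0 ∧ qp i = 0))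
    (hm : ∀ i, (lom ≤ a i ∧ a i ≤ upm) ∨ (Xm i = 0 ∧ qm i = 0))
    (hlop : 0 ≤ lop) (hlom : 0 ≤ lom) (hupp : 0 ≤ upp) (hupm : 0 ≤ upm)
    (hk1 : 0 ≤ k₁) (hk12 : k₁ ≤ k₂) (hk : ∀ i, k₁ ≤ 1 - qp i ^ 2 ∧ 1 - qp i ^ 2 ≤ k₂)
    (hs1 : 0 ≤ s₁) (hs12 : s₁ ≤ s₂) (hs : ∀ i, s₁ ≤ 1 + qm i ^ 2 ∧ 1 + qm i ^ 2 ≤ s₂)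
    (hs2 : s₂ * P.nuMax ≤ 2)
    (ht1 : 0 ≤ t₁) (ht12 : t₁ ≤ t₂)
    (ht : ∀ i, t₁ ≤ 1 - qp i ^ 2 + qm i ^ 2 ∧ 1 - qp i ^ 2 + qm i ^ 2 ≤ t₂)
    (hκ0 : 0 ≤ κ) (hκ : ∀ i, a i * qp i ^ 2 ≤ κ)
    (hκm0 : 0 ≤ κm) (hκm : ∀ i, a i * qm i ^ 2 ≤ κm)
    (hσp0 : 0 ≤ σp) (hσp : ∀ i, qp i ^ 2 ≤ σp * a i) (hξp : σp * P.nuMax * P.omegaMax = ξp)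
    (hσ0 : 0 ≤ σm) (hσ : ∀ i, qm i ^ 2 ≤ σm * a i) (hξm : σm * P.nuMax = ξm)
    (hl1 : ηl ≤ lop * g₁ ξp)
    (hl2 : ηl ≤ (P.hMin (s₂ * P.nuMax) + P.omegaMin * (1 - s₂ * P.nuMax)) * g₁ ξp)
    (hl3 : ηl ≤ lom * g₁ ξm) (hl4 : ηl ≤ k₁ * P.nuMin * g₁ ξm)
    (hu1 : upp * g₂ ξp ≤ ηu)
    (hu2 : (P.hMax (s₂ * P.nuMax) + P.omegaMax * (1 - s₁ * P.nuMin)) * g₂ ξp ≤ ηu)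
    (hu3 : upm * g₂ ξm ≤ ηu) (hu4 : k₂ * P.nuMax * g₂ ξm ≤ ηu)
    (hρ : P.omegaMax * (P.nuMax * κm + varrho (t₂ * P.nuMax) (t₁ * P.nuMin)) + P.nuMax * κ ≤ ρ) :
    ηl ≤ z.re ∧ z.re ≤ ηu ∧ |z.im| ≤ √ρ := by
  have ha := N.a_pos
  have hβ := hE.hβ
  have hG := hE.hG
  have hγ := hE.hγ
  rw [hG] at hγ
  have hν := N.nuMax_nonneg
  have hω := N.omegaMax_nonneg
  have R := re_bounds (lw := P.hMin (s₂ * P.nuMax) + P.omegaMin * (1 - s₂ * P.nuMax))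
    (uw := P.hMax (s₂ * P.nuMax) + P.omegaMax * (1 - s₁ * P.nuMin))
    (ly := k₁ * P.nuMin) (uy := k₂ * P.nuMax)
    (ξp := ξp) (ξm := ξm) (ηl := ηl) (ηu := ηu) ha hE hne
    (hξp ▸ mul_nonneg (mul_nonneg hσp0 hν) hω) (hξm ▸ mul_nonneg hσ0 hν) hp hm
    hlop hlom hupp hupm (N.schur_lower_nonneg hs2) (mul_nonneg hk1 N.nuMin_nonneg)
    (by
      rw [hγ, hG]
      simpa using N.schur_bounds hs1 hs12
        (fun i => div_le_div_of_nonneg_right (hs i).1 (ha i).le)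
        (fun i => div_le_div_of_nonneg_right (hs i).2 (ha i).le) hs2 W)
    (by
      rw [hβ]
      exact ⟨N.le_sum_normSq hk1 (fun i => div_le_div_of_nonneg_right (hk i).1 (ha i).le) Y,
        N.sum_normSq_le (hk1.trans hk12)
          (fun i => div_le_div_of_nonneg_right (hk i).2 (ha i).le) Y⟩)
    (by
      rw [hγ, ← hξp]
      refine N.sum_normSq_comp_le hσp0 (fun i => ?_) W
      have := ha i
      rw [one_mul, div_pow, div_le_div_iff₀ (by positivity) this]
      calc qp i ^ 2 * a i ≤ σp * a i * a i := by gcongr; exact hσp i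
        _ = _ := by ring)
    (by
      rw [hβ, ← hξm]
      refine N.sum_normSq_le hσ0 (fun i => ?_) Y
      have := ha i
      rw [div_pow, div_le_div_iff₀ (by positivity) this]
      calc qm i ^ 2 * a i ≤ σm * a i * a i := by gcongr; exact hσ i
        _ = _ := by ring)
    hl1 hl2 hl3 hl4 hu1 hu2 hu3 hu4
  refine ⟨R.1, R.2, ?_⟩
  refine im_bound (p := κ * P.nuMax)
    (q := P.omegaMax * varrho (t₂ * P.nuMax) (t₁ * P.nuMin))
    (r := κm * P.nuMax * P.omegaMax) hE hne (mul_nonneg hκ0 hν)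
    (mul_nonneg hω (varrho_nonneg _ _)) (mul_nonneg (mul_nonneg hκm0 hν) hω)
    ?_ ?_ ?_ (by linarith)
  · rw [hβ]
    refine N.sum_normSq_le hκ0 (fun i => ?_) Y
    rw [le_div_iff₀ (ha i), mul_comm]
    exact hκ i
  · rw [hγ]
    refine N.sum_normSq_comp_le hκm0 (fun i => ?_) W
    rw [le_div_iff₀ (ha i), mul_comm, one_mul]
    exact hκm i
  · rw [hγ, hG, hβ, one_mul]
    exact N.coupling_bound ht1 ht12
      (fun i => div_le_div_of_nonneg_right (ht i).1 (ha i).le)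
      (fun i => div_le_div_of_nonneg_right (ht i).2 (ha i).le) W Y

end BlockData.NormalForm

namespace BlockData.NormalForm

variable {n m l : ℕ} {P : BlockData n m l} {a : Fin n → ℝ} {B : Matrix (Fin m) (Fin n) ℝ}
  {C : Matrix (Fin l) (Fin m) ℝ} {d : Fin l → ℝ} {z : ℂ}

/-! ### Equal lower and upper factors -/

lemma deltaMin_le (N : NormalForm P a B C d) (i : Fin n) : P.deltaMin ≤ a i * (2 - a i) := by
  have h1 := N.muMin_le i
  have h2 := N.le_muMax i
  unfold deltaMin
  -- `t ↦ t (2 - t)` is concave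
  rcases le_total (P.muMin + P.muMax) 2 with h | h
  · exact (min_le_left _ _).trans (by nlinarith)
  · exact (min_le_right _ _).trans (by nlinarith)

lemma le_deltaMax (i : Fin n) : a i * (2 - a i) ≤ P.deltaMax :=
  le_max_of_le_right (by nlinarith [sq_nonneg (a i - 1)])

lemma deltaMin_nonneg (N : NormalForm P a B C d) (hμ : P.muMax ≤ 2) : 0 ≤ P.deltaMin := by
  have h1 := N.muMin_pos
  have h2 := N.muMin_le_muMax
  exact le_min (mul_nonneg h1.le (by linarith)) (mul_nonneg (by linarith) (by linarith))

lemma deltaMin_le_one (N : NormalForm P a B C d) : P.deltaMin ≤ 1 := by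
  obtain ⟨i, -⟩ := N.exists_muMin
  exact (N.deltaMin_le i).trans (by nlinarith [sq_nonneg (a i - 1)])

lemma deltaMin_le_deltaMax (N : NormalForm P a B C d) : P.deltaMin ≤ P.deltaMax := by
  obtain ⟨i, -⟩ := N.exists_muMin
  exact (N.deltaMin_le i).trans (le_deltaMax i)

lemma kappa₂_nonneg (N : NormalForm P a B C d) : 0 ≤ P.kappa₂ := by
  obtain ⟨i, -⟩ := N.exists_muMin
  exact (mul_nonneg (sq_nonneg _) (N.a_pos i).le).trans (N.kappa₂ i)

lemma bounds_d (N : NormalForm P a B C d)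
    (h : IsPencilEigenvalue (normK a B C d) (normM B C 0 0 0) z) :
    P.etaMin .d ≤ z.re ∧ z.re ≤ P.etaMax .d ∧ |z.im| ≤ P.rho .d := by
  obtain ⟨Xp, β, γ, Y, G, W, hne, hE⟩ := h.exists_reduced_symm N.a_pos
  have h1 := N.muMin_pos.le
  have h2 := h1.trans N.muMin_le_muMax
  refine N.bounds_uncoupled (lop := P.muMin) (upp := P.muMax) (lom := 0) (upm := 0) (k₁ := 0)
    (k₂ := 0) (σm := 0) (κ := P.muMax) (ξm := 0) hE hne
    (fun i => Or.inl ⟨N.muMin_le i, N.le_muMax i⟩) (fun i => Or.inr ⟨rfl, rfl⟩)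
    h1 le_rfl h2 le_rfl le_rfl le_rfl (fun i => by simp) h2 (fun i => by simpa using N.le_muMax i)
    le_rfl (fun i => by simp) (by simp) h1 N.tauMin_nonneg (by simp [etaMin]) (by simp [etaMin])
    (le_max_left _ _) (le_max_right _ _) ?_ ?_ le_rfl
  · rw [zero_mul]; exact h2.trans (le_max_left _ _)
  · rw [zero_mul, zero_mul]; exact h2.trans (le_max_left _ _)

lemma bounds_f1 (N : NormalForm P a B C d) (hμ : P.muMax ≤ 2)
    (h : IsPencilEigenvalue (normK a B C d) (normM B C 1 1 0) z) :
    P.etaMin .f1 ≤ z.re ∧ z.re ≤ P.etaMax .f1 ∧ |z.im| ≤ P.rho .f1 := by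
  obtain ⟨Xp, β, γ, Y, G, W, hne, hE⟩ := h.exists_reduced_symm N.a_pos
  have h1 := N.muMin_pos.le
  have h2 := h1.trans N.muMin_le_muMax
  have hδ := N.deltaMin_nonneg hμ
  have hδν := mul_nonneg hδ N.nuMin_nonneg
  have hδν' := mul_nonneg (hδ.trans N.deltaMin_le_deltaMax) N.nuMax_nonneg
  refine N.bounds_uncoupled (lop := P.muMin) (upp := P.muMax) (lom := P.deltaMin * P.nuMin)
    (upm := P.deltaMax * P.nuMax) (k₁ := P.deltaMin)
    (k₂ := P.deltaMax) (σm := 0) (κ := P.kappa₂) (ξm := 0) hE hne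
    (fun i => Or.inl ⟨N.muMin_le i, N.le_muMax i⟩) (fun i => Or.inr ⟨rfl, rfl⟩)
    h1 hδν h2 hδν' hδ N.deltaMin_le_deltaMax
    (fun i => ?_) N.kappa₂_nonneg (fun i => by simpa [mul_comm] using N.kappa₂ i)
    le_rfl (fun i => by simp) (by simp)
    ((min_le_left _ _).trans (min_le_left _ _)) ((min_le_left _ _).trans (min_le_right _ _))
    ?_ ?_
    ((le_max_left _ _).trans (le_max_left _ _)) ((le_max_right _ _).trans (le_max_left _ _))
    ?_ ?_ le_rfl
  · have e : 1 - (1 - 1 * a i) ^ 2 = a i * (2 - a i) := by ring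
    rw [e]
    exact ⟨N.deltaMin_le i, le_deltaMax i⟩
  · rw [g₁_zero, mul_one]; exact min_le_right _ _
  · rw [g₁_zero, mul_one]; exact min_le_right _ _
  · rw [g₂_zero, mul_one]; exact le_max_right _ _
  · rw [g₂_zero, mul_one]; exact le_max_right _ _

lemma bounds_f2 (N : NormalForm P a B C d) (hν : P.nuMax ≤ 2)
    (h : IsPencilEigenvalue (normK a B C d) (normM B C 0 0 1) z) :
    P.etaMin .f2 ≤ z.re ∧ z.re ≤ P.etaMax .f2 ∧ |z.im| ≤ P.rho .f2 := by
  obtain ⟨Xp, β, γ, Y, G, W, hne, hE⟩ := h.exists_reduced_symm N.a_pos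
  have h0 := N.muMin_pos
  have h1 := h0.le
  have h2 := h1.trans N.muMin_le_muMax
  have hξ : 0 ≤ P.xi₂ := div_nonneg (mul_nonneg N.omegaMax_nonneg N.nuMax_nonneg) h1
  have hg1 := (g₁_pos hξ).le
  have hg2 : 0 ≤ g₂ P.xi₂ := zero_le_one.trans (one_le_g₂ hξ)
  have hu : 0 ≤ P.etaMax .f2 := mul_nonneg (h2.trans (le_max_left _ _)) hg2
  refine N.bounds_coupled (lop := P.muMin) (upp := P.muMax) (lom := 0) (upm := 0)
    (k₁ := 0) (k₂ := 0) (s₁ := 1) (s₂ := 1) (t₁ := 0) (t₂ := 0) (σp := 1 / P.muMin)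
    (σm := 0) (κ := P.muMax) (κm := 0) (ξp := P.xi₂) (ξm := 0) hE hne
    (fun i => Or.inl ⟨N.muMin_le i, N.le_muMax i⟩) (fun i => Or.inr ⟨rfl, rfl⟩)
    h1 le_rfl h2 le_rfl le_rfl le_rfl (fun i => by simp)
    zero_le_one le_rfl (fun i => by simp) (by linarith)
    le_rfl le_rfl (fun i => by simp) h2 (fun i => by simpa using N.le_muMax i)
    le_rfl (fun i => by simp) (by positivity) (fun i => ?_) (by unfold xi₂; ring)
    le_rfl (fun i => by simp) (by simp) (mul_nonneg h1 hg1)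
    (mul_nonneg (N.schur_lower_nonneg (by linarith)) hg1)
    (by simp [etaMin]) (by simp [etaMin]) ?_ ?_ ?_ ?_ ?_
  · have := N.muMin_le i
    have e : (1 - 0 * a i) ^ 2 = 1 := by ring
    rw [e, one_div, inv_mul_eq_div, le_div_iff₀ h0]
    linarith
  · exact mul_le_mul_of_nonneg_right (le_max_left _ _) hg2
  · rw [one_mul, one_mul]
    exact mul_le_mul_of_nonneg_right (le_max_right _ _) hg2
  · rwa [zero_mul]
  · rwa [zero_mul, zero_mul]
  · simp [rhoSq, varrho]

lemma bounds_f5 (N : NormalForm P a B C d) (hμ : P.muMax ≤ 2) (hν : P.nuMax ≤ 2)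
    (h : IsPencilEigenvalue (normK a B C d) (normM B C 1 1 1) z) :
    P.etaMin .f5 ≤ z.re ∧ z.re ≤ P.etaMax .f5 ∧ |z.im| ≤ P.rho .f5 := by
  obtain ⟨Xp, β, γ, Y, G, W, hne, hE⟩ := h.exists_reduced_symm N.a_pos
  have h0 := N.muMin_pos
  have h1 := h0.le
  have h2 := h1.trans N.muMin_le_muMax
  have hδ := N.deltaMin_nonneg hμ
  have hδ1 := N.deltaMin_le_one
  have hδν := mul_nonneg hδ N.nuMin_nonneg
  have hδν' := mul_nonneg (hδ.trans N.deltaMin_le_deltaMax) N.nuMax_nonneg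
  have hξ2 : 0 ≤ P.xi₂ := div_nonneg (mul_nonneg N.omegaMax_nonneg N.nuMax_nonneg) h1
  have hξ : 0 ≤ P.xi₄ := mul_nonneg (by linarith) hξ2
  have hg1 := g₁_pos hξ
  have hg2 : 0 < g₂ P.xi₄ := zero_lt_one.trans_le (one_le_g₂ hξ)
  have ek : ∀ i, 1 - (1 - 1 * a i) ^ 2 = a i * (2 - a i) := fun i => by ring
  refine N.bounds_coupled (lop := P.muMin) (upp := P.muMax) (lom := P.deltaMin * P.nuMin)
    (upm := P.deltaMax * P.nuMax)
    (k₁ := P.deltaMin) (k₂ := P.deltaMax) (s₁ := 1) (s₂ := 1) (t₁ := P.deltaMin)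
    (t₂ := P.deltaMax) (σp := (1 - P.deltaMin) / P.muMin)
    (σm := 0) (κ := P.kappa₂) (κm := 0) (ξp := P.xi₄) (ξm := 0) hE hne
    (fun i => Or.inl ⟨N.muMin_le i, N.le_muMax i⟩) (fun i => Or.inr ⟨rfl, rfl⟩)
    h1 hδν h2 hδν' hδ N.deltaMin_le_deltaMax
    (fun i => by rw [ek]; exact ⟨N.deltaMin_le i, le_deltaMax i⟩)
    zero_le_one le_rfl (fun i => by simp) (by linarith)
    hδ N.deltaMin_le_deltaMax (fun i => ?_)
    N.kappa₂_nonneg (fun i => by simpa [mul_comm] using N.kappa₂ i)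
    le_rfl (fun i => by simp) (div_nonneg (by linarith) h1) (fun i => ?_)
    (by unfold xi₄ xi₂; ring)
    le_rfl (fun i => by simp) (by simp) ?_ ?_ ?_ ?_ ?_ ?_ ?_ ?_ ?_
  · rw [ek, Pi.zero_apply]
    simpa using ⟨N.deltaMin_le i, le_deltaMax (P := P) i⟩
  · have e1 := N.muMin_le i
    have e2 := N.deltaMin_le i
    rw [div_mul_eq_mul_div, le_div_iff₀ h0]
    calc (1 - 1 * a i) ^ 2 * P.muMin ≤ (1 - P.deltaMin) * P.muMin := by
          gcongr
          linarith [ek i]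
      _ ≤ (1 - P.deltaMin) * a i := by
          gcongr
  · exact mul_le_mul_of_nonneg_right ((min_le_left _ _).trans (min_le_left _ _)) hg1.le
  · rw [one_mul]
    exact mul_le_mul_of_nonneg_right ((min_le_left _ _).trans (min_le_right _ _)) hg1.le
  · rw [g₁_zero, mul_one]; exact (le_div_iff₀ hg1).1 (min_le_right _ _)
  · rw [g₁_zero, mul_one]; exact (le_div_iff₀ hg1).1 (min_le_right _ _)
  · exact mul_le_mul_of_nonneg_right ((le_max_left _ _).trans (le_max_left _ _)) hg2.le
  · rw [one_mul, one_mul]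
    exact mul_le_mul_of_nonneg_right ((le_max_right _ _).trans (le_max_left _ _)) hg2.le
  · rw [g₂_zero, mul_one]; exact (div_le_iff₀ hg2).1 (le_max_right _ _)
  · rw [g₂_zero, mul_one]; exact (div_le_iff₀ hg2).1 (le_max_right _ _)
  · simp [rhoSq]

/-! ### The factor `E` on one side only -/

/-- The weights `qp = √(1 - a)` and `qm = √(a - 1)` of the coupling `p = 1 - a`: the second one is
`0` here, as the real square root of a nonpositive number. -/
lemma sqrt_one_sub_sq_of_le {t : ℝ} (h : t ≤ 1) : √(1 - t) ^ 2 = 1 - t ∧ √(t - 1) ^ 2 = 0 :=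
  ⟨Real.sq_sqrt (by linarith), by rw [Real.sqrt_eq_zero_of_nonpos (by linarith)]; ring⟩

lemma sqrt_one_sub_sq_of_ge {t : ℝ} (h : 1 ≤ t) : √(1 - t) ^ 2 = 0 ∧ √(t - 1) ^ 2 = t - 1 :=
  ⟨by rw [Real.sqrt_eq_zero_of_nonpos (by linarith)]; ring, Real.sq_sqrt (by linarith)⟩

lemma xi₁_eq (N : NormalForm P a B C d) : (P.muMax - 1) / P.muMax * P.nuMax = P.xi₁ := by
  have := N.muMin_pos.trans_le N.muMin_le_muMax
  unfold xi₁
  field_simp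

lemma xi₃_eq : (1 - P.muMin) / P.muMin * P.nuMax * P.omegaMax = P.xi₃ := by
  unfold xi₃ xi₂
  ring

lemma sub_one_le (N : NormalForm P a B C d) (i : Fin n) :
    a i - 1 ≤ (P.muMax - 1) / P.muMax * a i := by
  have := N.muMin_pos.trans_le N.muMin_le_muMax
  have h := N.le_muMax i
  rw [div_mul_eq_mul_div, le_div_iff₀ this]
  linarith

lemma one_sub_le (N : NormalForm P a B C d) (i : Fin n) :
    1 - a i ≤ (1 - P.muMin) / P.muMin * a i := by
  have h := N.muMin_le i
  rw [div_mul_eq_mul_div, le_div_iff₀ N.muMin_pos]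
  linarith

lemma bounds_lt (N : NormalForm P a B C d)
    (h : IsPencilEigenvalue (normK a B C d) (normM B C 1 0 0) z) :
    P.etaMin .lt ≤ z.re ∧ z.re ≤ P.etaMax .lt ∧ |z.im| ≤ P.rho .lt := by
  have h0 := N.muMin_pos
  have h1 := h0.le
  have h2 := h1.trans N.muMin_le_muMax
  have hτ := N.tauMin_nonneg.trans N.tauMin_le_tauMax
  by_cases c1 : P.muMax ≤ 1
  · have hle : ∀ i, a i ≤ 1 := fun i => (N.le_muMax i).trans c1
    obtain ⟨Xp, Xm, β, γ, Y, G, W, hne, hE, hpos, -⟩ :=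
      h.exists_reduced_triangular N.a_pos (fun _ => True) (fun i _ => hle i)
        (fun i hi => absurd trivial hi)
    have hq := fun i => sqrt_one_sub_sq_of_le (hle i)
    have hκ : 0 ≤ P.kappa₁ := by
      obtain ⟨i, -⟩ := N.exists_muMin
      exact (mul_nonneg (N.a_pos i).le (sub_nonneg.2 (hle i))).trans (N.kappa₁ i)
    simp only [rho, etaMin, etaMax, rhoSq, if_pos c1]
    refine N.bounds_uncoupled (lop := P.muMin) (upp := P.muMax) (lom := P.muMin * P.nuMin)
      (upm := P.muMax * P.nuMax) (k₁ := P.muMin) (k₂ := P.muMax) (σm := 0) (κ := P.kappa₁)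
      (ξm := 0) hE hne (fun i => Or.inl ⟨N.muMin_le i, N.le_muMax i⟩)
      (fun i => Or.inr (hpos i trivial)) h1 (mul_nonneg h1 N.nuMin_nonneg) h2
      (mul_nonneg h2 N.nuMax_nonneg) h1 N.muMin_le_muMax (fun i => ?_) hκ (fun i => ?_)
      le_rfl (fun i => ?_) (by simp)
      ((min_le_left _ _).trans (min_le_left _ _)) ((min_le_left _ _).trans (min_le_right _ _))
      ?_ ?_
      ((le_max_left _ _).trans (le_max_left _ _)) ((le_max_right _ _).trans (le_max_left _ _))
      ?_ ?_ le_rfl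
    · rw [(hq i).1, sub_sub_cancel]
      exact ⟨N.muMin_le i, N.le_muMax i⟩
    · rw [(hq i).1]; exact N.kappa₁ i
    · rw [(hq i).2, zero_mul]
    · rw [g₁_zero, mul_one]; exact min_le_right _ _
    · rw [g₁_zero, mul_one]; exact min_le_right _ _
    · rw [g₂_zero, mul_one]; exact le_max_right _ _
    · rw [g₂_zero, mul_one]; exact le_max_right _ _
  · have hμ1 : 1 < P.muMax := not_le.1 c1
    have hσ0 : 0 ≤ (P.muMax - 1) / P.muMax := div_nonneg (by linarith) h2
    have hξ : 0 ≤ P.xi₁ := N.xi₁_eq ▸ mul_nonneg hσ0 N.nuMax_nonneg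
    have hg1 := (g₁_pos hξ).le
    have hg2 := zero_le_one.trans (one_le_g₂ hξ)
    by_cases c2 : 1 ≤ P.muMin
    · have hge : ∀ i, 1 ≤ a i := fun i => c2.trans (N.muMin_le i)
      obtain ⟨Xp, Xm, β, γ, Y, G, W, hne, hE, -, hneg⟩ :=
        h.exists_reduced_triangular N.a_pos (fun _ => False) (fun i hi => hi.elim)
          (fun i _ => hge i)
      have hq := fun i => sqrt_one_sub_sq_of_ge (hge i)
      simp only [rho, etaMin, etaMax, rhoSq, if_neg c1, if_pos c2]
      refine N.bounds_uncoupled (lop := P.tauMin) (upp := P.tauMax) (lom := P.muMin)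
        (upm := P.muMax) (k₁ := 1) (k₂ := 1) (σm := (P.muMax - 1) / P.muMax) (κ := 0)
        (ξm := P.xi₁) hE hne (fun i => Or.inr (hneg i id))
        (fun i => Or.inl ⟨N.muMin_le i, N.le_muMax i⟩) N.tauMin_nonneg h1 hτ h2
        zero_le_one le_rfl (fun i => by rw [(hq i).1]; simp) le_rfl
        (fun i => by rw [(hq i).1]; simp)
        hσ0 (fun i => by rw [(hq i).2]; exact N.sub_one_le i) N.xi₁_eq
        (min_le_right _ _) (min_le_right _ _) ((min_le_left _ _).trans (min_le_left _ _)) ?_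
        (le_max_right _ _) (le_max_right _ _) ((le_max_left _ _).trans (le_max_left _ _)) ?_
        (by simp)
      · rw [one_mul]; exact (min_le_left _ _).trans (min_le_right _ _)
      · rw [one_mul]; exact (le_max_right _ _).trans (le_max_left _ _)
    · have hμ' : P.muMin < 1 := not_le.1 c2
      obtain ⟨Xp, Xm, β, γ, Y, G, W, hne, hE, hpos, hneg⟩ :=
        h.exists_reduced_triangular N.a_pos (fun i => a i ≤ 1) (fun i hi => hi)
          (fun i hi => (not_le.1 hi).le)
      have hκ : 0 ≤ P.kappa₁ := by
        obtain ⟨i, hi⟩ := N.exists_muMin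
        exact (mul_nonneg (N.a_pos i).le (by linarith)).trans (N.kappa₁ i)
      simp only [rho, etaMin, etaMax, rhoSq, if_neg c1, if_neg c2]
      refine N.bounds_uncoupled (lop := P.muMin) (upp := 1) (lom := 1)
        (upm := P.muMax) (k₁ := P.muMin) (k₂ := 1) (σm := (P.muMax - 1) / P.muMax)
        (κ := P.kappa₁) (ξm := P.xi₁) hE hne (fun i => ?_) (fun i => ?_)
        h1 zero_le_one zero_le_one h2 h1 hμ'.le (fun i => ?_) hκ (fun i => ?_) hσ0 (fun i => ?_)
        N.xi₁_eq
        ((min_le_left _ _).trans ((min_le_left _ _).trans (min_le_left _ _)))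
        ((min_le_left _ _).trans ((min_le_left _ _).trans (min_le_right _ _)))
        ?_ (min_le_right _ _) ?_ ((le_max_left _ _).trans (le_max_left _ _))
        ((le_max_right _ _).trans (le_max_left _ _)) ?_ le_rfl
      · rcases le_or_gt (a i) 1 with hi | hi
        · exact Or.inl ⟨N.muMin_le i, hi⟩
        · exact Or.inr (hneg i (not_le.2 hi))
      · rcases le_or_gt (a i) 1 with hi | hi
        · exact Or.inr (hpos i hi)
        · exact Or.inl ⟨hi.le, N.le_muMax i⟩
      · rcases le_total (a i) 1 with hi | hi
        · rw [(sqrt_one_sub_sq_of_le hi).1, sub_sub_cancel]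
          exact ⟨N.muMin_le i, hi⟩
        · rw [(sqrt_one_sub_sq_of_ge hi).1, sub_zero]
          exact ⟨hμ'.le, le_rfl⟩
      · rcases le_total (a i) 1 with hi | hi
        · rw [(sqrt_one_sub_sq_of_le hi).1]; exact N.kappa₁ i
        · rw [(sqrt_one_sub_sq_of_ge hi).1, mul_zero]; exact hκ
      · rcases le_total (a i) 1 with hi | hi
        · rw [(sqrt_one_sub_sq_of_le hi).2]; exact mul_nonneg hσ0 (N.a_pos i).le
        · rw [(sqrt_one_sub_sq_of_ge hi).2]; exact N.sub_one_le i
      · rw [one_mul]; exact (min_le_left _ _).trans (min_le_right _ _)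
      · have : 1 ≤ P.muMax * g₂ P.xi₁ := one_le_mul_of_one_le_of_one_le hμ1.le (one_le_g₂ hξ)
        exact this.trans ((le_max_right _ _).trans (le_max_left _ _))
      · rw [one_mul]; exact le_max_right _ _

lemma bounds_f4 (N : NormalForm P a B C d) (hν : P.nuMax ≤ 2) (hμν : P.muMax * P.nuMax < 2)
    (h : IsPencilEigenvalue (normK a B C d) (normM B C 1 0 1) z) :
    P.etaMin .f4 ≤ z.re ∧ z.re ≤ P.etaMax .f4 ∧ |z.im| ≤ P.rho .f4 := by
  have h0 := N.muMin_pos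
  have h1 := h0.le
  have h2 := h1.trans N.muMin_le_muMax
  -- in all cases `1 - qp² + qm² = a`
  have hT : ∀ i, P.muMin ≤ 1 - √(1 - a i) ^ 2 + √(a i - 1) ^ 2 ∧
      1 - √(1 - a i) ^ 2 + √(a i - 1) ^ 2 ≤ P.muMax := by
    intro i
    have e : 1 - √(1 - a i) ^ 2 + √(a i - 1) ^ 2 = a i := by
      rcases le_total (a i) 1 with hi | hi
      · rw [(sqrt_one_sub_sq_of_le hi).1, (sqrt_one_sub_sq_of_le hi).2]; ring
      · rw [(sqrt_one_sub_sq_of_ge hi).1, (sqrt_one_sub_sq_of_ge hi).2]; ring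
    rw [e]
    exact ⟨N.muMin_le i, N.le_muMax i⟩
  by_cases c1 : P.muMax ≤ 1
  · have hle : ∀ i, a i ≤ 1 := fun i => (N.le_muMax i).trans c1
    obtain ⟨Xp, Xm, β, γ, Y, G, W, hne, hE, hpos, -⟩ :=
      h.exists_reduced_triangular N.a_pos (fun _ => True) (fun i _ => hle i)
        (fun i hi => absurd trivial hi)
    have hq := fun i => sqrt_one_sub_sq_of_le (hle i)
    have hκ : 0 ≤ P.kappa₁ := by
      obtain ⟨i, -⟩ := N.exists_muMin
      exact (mul_nonneg (N.a_pos i).le (sub_nonneg.2 (hle i))).trans (N.kappa₁ i)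
    have hσ0 : 0 ≤ (1 - P.muMin) / P.muMin :=
      div_nonneg (by linarith [N.muMin_le_muMax]) h1
    have hξ : 0 ≤ P.xi₃ :=
      xi₃_eq (P := P) ▸ mul_nonneg (mul_nonneg hσ0 N.nuMax_nonneg) N.omegaMax_nonneg
    have hg1 := g₁_pos hξ
    have hg2 := zero_lt_one.trans_le (one_le_g₂ hξ)
    simp only [rho, etaMin, etaMax, rhoSq, if_pos c1]
    refine N.bounds_coupled (lop := P.muMin) (upp := P.muMax) (lom := P.muMin * P.nuMin)
      (upm := P.muMax * P.nuMax) (k₁ := P.muMin) (k₂ := P.muMax) (s₁ := 1) (s₂ := 1)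
      (t₁ := P.muMin) (t₂ := P.muMax) (σp := (1 - P.muMin) / P.muMin) (σm := 0) (κ := P.kappa₁)
      (κm := 0) (ξp := P.xi₃) (ξm := 0) hE hne
      (fun i => Or.inl ⟨N.muMin_le i, N.le_muMax i⟩)
      (fun i => Or.inr (hpos i trivial)) h1 (mul_nonneg h1 N.nuMin_nonneg) h2
      (mul_nonneg h2 N.nuMax_nonneg) h1 N.muMin_le_muMax (fun i => ?_)
      zero_le_one le_rfl (fun i => by rw [(hq i).2]; simp) (by linarith) h1 N.muMin_le_muMax hT
      hκ (fun i => ?_) le_rfl (fun i => by rw [(hq i).2]; simp)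
      hσ0 (fun i => by rw [(hq i).1]; exact N.one_sub_le i) xi₃_eq
      le_rfl (fun i => by rw [(hq i).2]; simp) (by simp) ?_ ?_ ?_ ?_ ?_ ?_ ?_ ?_ (by simp)
    · rw [(hq i).1, sub_sub_cancel]
      exact ⟨N.muMin_le i, N.le_muMax i⟩
    · rw [(hq i).1]; exact N.kappa₁ i
    · exact mul_le_mul_of_nonneg_right ((min_le_left _ _).trans (min_le_left _ _)) hg1.le
    · rw [one_mul]
      exact mul_le_mul_of_nonneg_right ((min_le_left _ _).trans (min_le_right _ _)) hg1.le
    · rw [g₁_zero, mul_one]; exact (le_div_iff₀ hg1).1 (min_le_right _ _)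
    · rw [g₁_zero, mul_one]; exact (le_div_iff₀ hg1).1 (min_le_right _ _)
    · exact mul_le_mul_of_nonneg_right ((le_max_left _ _).trans (le_max_left _ _)) hg2.le
    · rw [one_mul, one_mul]
      exact mul_le_mul_of_nonneg_right ((le_max_right _ _).trans (le_max_left _ _)) hg2.le
    · rw [g₂_zero, mul_one]; exact (div_le_iff₀ hg2).1 (le_max_right _ _)
    · rw [g₂_zero, mul_one]; exact (div_le_iff₀ hg2).1 (le_max_right _ _)
  · have hμ1 : 1 < P.muMax := not_le.1 c1
    have hσ0 : 0 ≤ (P.muMax - 1) / P.muMax := div_nonneg (by linarith) h2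
    have hξ : 0 ≤ P.xi₁ := N.xi₁_eq ▸ mul_nonneg hσ0 N.nuMax_nonneg
    have hg1 := (g₁_pos hξ).le
    have hg2 := zero_le_one.trans (one_le_g₂ hξ)
    have hκm0 : 0 ≤ P.muMax * (P.muMax - 1) := mul_nonneg h2 (by linarith)
    have hκm : ∀ i, 1 ≤ a i → a i * (a i - 1) ≤ P.muMax * (P.muMax - 1) := fun i hi =>
      mul_le_mul (N.le_muMax i) (by linarith [N.le_muMax i]) (by linarith) h2
    by_cases c2 : 1 ≤ P.muMin
    · have hge : ∀ i, 1 ≤ a i := fun i => c2.trans (N.muMin_le i)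
      obtain ⟨Xp, Xm, β, γ, Y, G, W, hne, hE, -, hneg⟩ :=
        h.exists_reduced_triangular N.a_pos (fun _ => False) (fun i hi => hi.elim)
          (fun i _ => hge i)
      have hq := fun i => sqrt_one_sub_sq_of_ge (hge i)
      simp only [rho, etaMin, etaMax, rhoSq, if_neg c1, if_pos c2]
      refine N.bounds_coupled
        (lop := P.hMin (P.muMax * P.nuMax) + P.omegaMin * (1 - P.muMax * P.nuMax))
        (upp := 0) (lom := P.muMin)
        (upm := P.muMax) (k₁ := 1) (k₂ := 1) (s₁ := P.muMin) (s₂ := P.muMax) (t₁ := P.muMin)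
        (t₂ := P.muMax) (σp := 0) (σm := (P.muMax - 1) / P.muMax) (κ := 0)
        (κm := P.muMax * (P.muMax - 1)) (ξp := 0)
        (ξm := P.xi₁) hE hne (fun i => Or.inr (hneg i id))
        (fun i => Or.inl ⟨N.muMin_le i, N.le_muMax i⟩) (N.schur_lower_nonneg hμν.le) h1 le_rfl h2
        zero_le_one le_rfl (fun i => by rw [(hq i).1]; simp) h1 N.muMin_le_muMax
        (fun i => ?_) hμν.le h1 N.muMin_le_muMax hT le_rfl
        (fun i => by rw [(hq i).1]; simp) hκm0 (fun i => by rw [(hq i).2]; exact hκm i (hge i))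
        le_rfl (fun i => by rw [(hq i).1]; simp) (by simp)
        hσ0 (fun i => by rw [(hq i).2]; exact N.sub_one_le i) N.xi₁_eq
        ?_ ?_ ((min_le_left _ _).trans (min_le_left _ _)) ?_
        ?_ ?_ ((le_max_left _ _).trans (le_max_left _ _)) ?_ ?_
      · rw [(hq i).2, add_sub_cancel]
        exact ⟨N.muMin_le i, N.le_muMax i⟩
      · rw [g₁_zero, mul_one]; exact min_le_right _ _
      · rw [g₁_zero, mul_one]; exact min_le_right _ _
      · rw [one_mul]; exact (min_le_left _ _).trans (min_le_right _ _)
      · rw [zero_mul]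
        exact (mul_nonneg h2 hg2).trans ((le_max_left _ _).trans (le_max_left _ _))
      · rw [g₂_zero, mul_one]; exact le_max_right _ _
      · rw [one_mul]; exact (le_max_right _ _).trans (le_max_left _ _)
      · exact le_of_eq (by ring)
    · have hμ' : P.muMin < 1 := not_le.1 c2
      obtain ⟨Xp, Xm, β, γ, Y, G, W, hne, hE, hpos, hneg⟩ :=
        h.exists_reduced_triangular N.a_pos (fun i => a i ≤ 1) (fun i hi => hi)
          (fun i hi => (not_le.1 hi).le)
      have hκ : 0 ≤ P.kappa₁ := by
        obtain ⟨i, hi⟩ := N.exists_muMin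
        exact (mul_nonneg (N.a_pos i).le (by linarith)).trans (N.kappa₁ i)
      have hσ0' : 0 ≤ (1 - P.muMin) / P.muMin := div_nonneg (by linarith) h1
      have hξ' : 0 ≤ P.xi₃ :=
        xi₃_eq (P := P) ▸ mul_nonneg (mul_nonneg hσ0' N.nuMax_nonneg) N.omegaMax_nonneg
      have hg1' := g₁_pos hξ'
      have hg2' := zero_lt_one.trans_le (one_le_g₂ hξ')
      simp only [rho, etaMin, etaMax, rhoSq, if_neg c1, if_neg c2]
      refine N.bounds_coupled (lop := P.muMin) (upp := 1) (lom := 1)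
        (upm := P.muMax) (k₁ := P.muMin) (k₂ := 1) (s₁ := 1) (s₂ := P.muMax) (t₁ := P.muMin)
        (t₂ := P.muMax) (σp := (1 - P.muMin) / P.muMin) (σm := (P.muMax - 1) / P.muMax)
        (κ := P.kappa₁) (κm := P.muMax * (P.muMax - 1)) (ξp := P.xi₃) (ξm := P.xi₁)
        hE hne (fun i => ?_) (fun i => ?_)
        h1 zero_le_one zero_le_one h2 h1 hμ'.le (fun i => ?_) zero_le_one hμ1.le (fun i => ?_)
        hμν.le h1 N.muMin_le_muMax hT hκ (fun i => ?_) hκm0 (fun i => ?_)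
        hσ0' (fun i => ?_) xi₃_eq hσ0 (fun i => ?_) N.xi₁_eq
        ?_ ?_ ?_ ?_ ?_ ?_ ?_ ?_ ?_
      · rcases le_or_gt (a i) 1 with hi | hi
        · exact Or.inl ⟨N.muMin_le i, hi⟩
        · exact Or.inr (hneg i (not_le.2 hi))
      · rcases le_or_gt (a i) 1 with hi | hi
        · exact Or.inr (hpos i hi)
        · exact Or.inl ⟨hi.le, N.le_muMax i⟩
      · rcases le_total (a i) 1 with hi | hi
        · rw [(sqrt_one_sub_sq_of_le hi).1, sub_sub_cancel]
          exact ⟨N.muMin_le i, hi⟩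
        · rw [(sqrt_one_sub_sq_of_ge hi).1, sub_zero]
          exact ⟨hμ'.le, le_rfl⟩
      · rcases le_total (a i) 1 with hi | hi
        · rw [(sqrt_one_sub_sq_of_le hi).2, add_zero]
          exact ⟨le_rfl, hμ1.le⟩
        · rw [(sqrt_one_sub_sq_of_ge hi).2, add_sub_cancel]
          exact ⟨hi, N.le_muMax i⟩
      · rcases le_total (a i) 1 with hi | hi
        · rw [(sqrt_one_sub_sq_of_le hi).1]; exact N.kappa₁ i
        · rw [(sqrt_one_sub_sq_of_ge hi).1, mul_zero]; exact hκ
      · rcases le_total (a i) 1 with hi | hi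
        · rw [(sqrt_one_sub_sq_of_le hi).2, mul_zero]; exact hκm0
        · rw [(sqrt_one_sub_sq_of_ge hi).2]; exact hκm i hi
      · rcases le_total (a i) 1 with hi | hi
        · rw [(sqrt_one_sub_sq_of_le hi).1]; exact N.one_sub_le i
        · rw [(sqrt_one_sub_sq_of_ge hi).1]; exact mul_nonneg hσ0' (N.a_pos i).le
      · rcases le_total (a i) 1 with hi | hi
        · rw [(sqrt_one_sub_sq_of_le hi).2]; exact mul_nonneg hσ0 (N.a_pos i).le
        · rw [(sqrt_one_sub_sq_of_ge hi).2]; exact N.sub_one_le i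
      · exact mul_le_mul_of_nonneg_right
          ((min_le_left _ _).trans ((min_le_left _ _).trans (min_le_left _ _))) hg1'.le
      · exact mul_le_mul_of_nonneg_right
          ((min_le_left _ _).trans ((min_le_left _ _).trans (min_le_right _ _))) hg1'.le
      · rw [one_mul]
        exact (le_div_iff₀ hg1').1 ((min_le_left _ _).trans (min_le_right _ _))
      · exact (le_div_iff₀ hg1').1 (min_le_right _ _)
      · exact mul_le_mul_of_nonneg_right
          ((le_max_left _ _).trans ((le_max_left _ _).trans (le_max_left _ _))) hg2'.le
      · rw [one_mul]
        exact mul_le_mul_of_nonneg_right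
          ((le_max_right _ _).trans ((le_max_left _ _).trans (le_max_left _ _))) hg2'.le
      · exact (div_le_iff₀ hg2').1 ((le_max_right _ _).trans (le_max_left _ _))
      · rw [one_mul]
        exact (div_le_iff₀ hg2').1 (le_max_right _ _)
      · exact le_of_eq (by ring)

end BlockData.NormalForm

end DoubleSaddle

end

theorem theorem5p1 {n m l : ℕ} (hn : 0 < n) (hm : 0 < m) (hl : 0 < l)
    (P : DoubleSaddle.BlockData n m l)
    (hA : P.A.PosDef) (hB : P.B.rank = m) (hD : P.D.PosSemidef)
    (hC : ¬ P.D.PosDef → P.C.rank = l)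
    (hMA : P.MA.PosDef) (hShat : P.Shat.PosDef) (hMShat : P.MShat.PosDef)
    (hmu : 0 < P.muMax ∧ P.muMax ≤ 2) (hnu : 0 < P.nuMax ∧ P.nuMax ≤ 2)
    (hmunu : 0 < P.muMax * P.nuMax ∧ P.muMax * P.nuMax < 2) :
    ∀ k : DoubleSaddle.Precond, ∀ z ∈ P.eigenvalues k,
      P.etaMin k ≤ z.re ∧ z.re ≤ P.etaMax k ∧ |z.im| ≤ P.rho k := by
  obtain ⟨a, B, C, d, N⟩ := DoubleSaddle.BlockData.exists_normalForm hn hm hl hA hD hMA hShat hMShat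
  intro k z hz
  have h := N.pencil k z hz
  -- the pencils of `ut` and `f3` are the transposes of those of `lt` and `f4`
  have ht := h.transpose
  rw [DoubleSaddle.normK_transpose, DoubleSaddle.normM_transpose] at ht
  cases k
  · exact N.bounds_d h
  · exact N.bounds_lt ht
  · exact N.bounds_lt h
  · exact N.bounds_f1 hmu.2 h
  · exact N.bounds_f2 hnu.2 h
  · exact N.bounds_f4 hnu.2 hmunu.2 ht
  · exact N.bounds_f4 hnu.2 hmunu.2 h
  · exact N.bounds_f5 hmu.2 hnu.2 h
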